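/- Setting. Let $\mathsf{x}=(\mathsf{x}_1,\dots,\mathsf{x}_M)^T$ be a zero-mean, jointly wide-sense stationary real vector process on $\mathbb{R}$ with finite variances and positive semidefinite power spectral density matrix $C_{\mathsf x}(f)\in\mathbb{C}^{M\times M}$ that is bandlimited: $C_{\mathsf x}(f)=0$ for $|f|>B$, for some $B$. Let $\mathsf{s}\in\mathbb{R}^N$ be a zero-mean square-integrable random vector whose MMSE estimate $\tilde{\mathsf s}=\mathbb{E}\{\mathsf s\mid\{\mathsf x_m(t)\}_{m,t}\}=(\Gamma*\mathsf x)(0)$ is linear, for a multivariate filter with frequency response $\Gamma(f)\in\mathbb{C}^{N\times M}$. An analog filter with frequency response $H(f)\in\mathbb{C}^{K\times M}$, $K\ge 1$, has the outputs $\mathsf y(t)=(H*\mathsf x)(t)\in\mathbb{R}^K$ (all filter outputs being understood in mean square). They are sampled with period $T_{\rm s}=1/f_{\rm s}$, $\mathsf y[n]=T_{\rm s}\,\mathsf y(nT_{\rm s})$, and quantized with $b\ge 1$ bits, dynamic range $\gamma>0$ and step size $\Delta=2\gamma/2^b$, where $\gamma^2=\eta^2\max_k\mathbb{E}\{(\mathsf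 y_k[n]+\mathsf w_k[n])^2\}$ for a fixed $\eta>0$ and $\mathsf w_k[n]$ is a dither, i.i.d. in $n$ and $k$, independent of $\mathsf x$, with density $\frac1\Delta(1-\frac{|w|}{\Delta})$ on $[-\Delta,\Delta]$. The integer $b$ and $\eta$ do not depend on $T_{\rm s}$, while $\gamma$, $\Delta$ and $\mathsf w$ do. The quantizer output is either $\mathsf z[n]=\mathsf y[n]+\mathsf e[n]$, with $\mathsf e$ uncorrelated with $\mathsf y$ and $\mathbb{E}\{\mathsf e[n+l]\mathsf e^T[n]\}=\frac{\Delta^2}{4}I_K\delta[l]$ (the equivalent quantizer model), or $\mathsf z_k[n]=q_b(\mathsf y_k[n]+\mathsf w_k[n])$ with zero overload probability, $\Pr\{|\mathsf y_k[n]+\mathsf w_k[n]|\ge\gamma\}=0$, where $q_b$ is the uniform mid-rise quantizer: $q_b(v)=\Delta(\lfloor v/\Delta\rfloor+\frac12)$ for $|v|<\gamma$ and $q_b(v)=\mathrm{sign}(v)(\gamma-\frac\Delta2)$ otherwise. The achievable MSE is the infimum of $\mathbb{E}\{\|\tilde{\mathsf s}-\hat{\mathsf s}\|^2\}$ over all linear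 digital recoveries $\hat{\mathsf s}=\sum_{n\in\mathbb Z}G[-n]\mathsf z[n]$, $G[n]\in\mathbb{R}^{N\times K}$; its closed-form expression is $$\mathrm{MSE}(H)=\mathbb{E}\{\|\tilde{\mathsf s}\|^2\}-\mathrm{tr}\Big(T_{\rm s}\int_{-f_{\rm s}/2}^{f_{\rm s}/2}S(f)\,C_{\mathsf z}(f)^{-1}S(f)^H\,df\Big),$$ where, writing $A_k(f)=A(f-kf_{\rm s})$, $S=\sum_{k\in\mathbb Z}\Gamma_kC_{\mathsf x,k}H_k^H$ and $C_{\mathsf z}=T_{\rm s}\sum_{k\in\mathbb Z}H_kC_{\mathsf x,k}H_k^H+\frac{\Delta^2}{4}I_K$. Sufficiency. For $\Upsilon\in\mathbb{N}$ put $\bar\Gamma=[\Gamma_{-\Upsilon}C_{\mathsf x,-\Upsilon}^{1/2},\dots,\Gamma_{\Upsilon}C_{\mathsf x,\Upsilon}^{1/2}]$ and $\bar H=[H_{-\Upsilon}C_{\mathsf x,-\Upsilon}^{1/2},\dots,H_{\Upsilon}C_{\mathsf x,\Upsilon}^{1/2}]$. The filter $H$ maintains sufficiency at $T_{\rm s}$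 if for every $f\in[-\frac{f_{\rm s}}2,\frac{f_{\rm s}}2]$ the column space of $\bar\Gamma^H(f)$ is contained in that of $\bar H^H(f)$, i.e. the orthogonal projection onto the column space of $\bar H^H(f)$ fixes $\bar\Gamma^H(f)$; where $\bar H\bar H^H$ is invertible this reads $\bar H^H(\bar H\bar H^H)^{-1}\bar H\bar\Gamma^H=\bar\Gamma^H$. Claim. If for some fixed $\Upsilon\in\mathbb{N}$ the filter $H$ maintains sufficiency for all sufficiently small $T_{\rm s}>0$, then, for every fixed number of bits $b\ge1$ (in particular for $b=1$), both the closed-form expression $\mathrm{MSE}(H)$ and the achievable MSE tend to zero as $T_{\rm s}\to0$. -/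

import Mathlib

open MeasureTheory ProbabilityTheory Filter Topology Matrix
open scoped ComplexOrder MatrixOrder ENNReal FourierTransform

namespace TaskADC

noncomputable section

/-- The sigma-algebra generated by the observed signals `x m t`, over all `m` and all `t`. -/
abbrev inputSigma {Ω : Type*} {M : ℕ} (x : Fin M → ℝ → Ω → ℝ) : MeasurableSpace Ω :=
  ⨆ m, ⨆ t, MeasurableSpace.comap (x m t) inferInstance

/-- `x` is a measurable, zero-mean, jointly wide-sense stationary real vector process with finite
variances and with power spectral density matrix `C`, that is
`E[x i (t + τ) * x j t] = ∫ C f i j * exp (2 π i f τ) df`. -/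
structure IsWSS {Ω : Type*} [MeasurableSpace Ω] (P : Measure Ω) {M : ℕ}
    (x : Fin M → ℝ → Ω → ℝ) (C : ℝ → Matrix (Fin M) (Fin M) ℂ) : Prop where
  measurable : ∀ m, Measurable (Function.uncurry (x m))
  memLp : ∀ m t, MemLp (x m t) 2 P
  mean_zero : ∀ m t, ∫ ω, x m t ω ∂P = 0
  posSemidef : ∀ f, (C f).PosSemidef
  integrable : ∀ i j, Integrable (fun f => C f i j)
  correlation : ∀ i j t τ, ((∫ ω, x i (t + τ) ω * x j t ω ∂P : ℝ) : ℂ) =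
    ∫ f : ℝ, C f i j * Complex.exp (2 * Real.pi * Complex.I * f * τ)

/-- The convolution `(h * x)(t)` of a matrix impulse response `h` with the vector process `x`. -/
def conv {Ω : Type*} {L M : ℕ} (h : Fin L → Fin M → ℝ → ℝ) (x : Fin M → ℝ → Ω → ℝ)
    (t : ℝ) (l : Fin L) (ω : Ω) : ℝ :=
  ∑ m, ∫ τ, h l m τ * x m (t - τ) ω

/-- The frequency response of a matrix impulse response: its entrywise Fourier transform
`∫ h l m t * exp (- 2 π i f t) dt`. -/
def freqResponse {L M : ℕ} (h : Fin L → Fin M → ℝ → ℝ) (f : ℝ) : Matrix (Fin L) (Fin M) ℂ :=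
  Matrix.of fun l m => 𝓕 (fun t : ℝ => ((h l m t : ℝ) : ℂ)) f

/-- The random vector `v` is the value at time `t` of the output of the multivariate filter with
frequency response `F` driven by `x` (with power spectral density `C`). For an integrable impulse
response `h` with `F = freqResponse h` this is the convolution `(h * x)(t)` (take the constant
sequence); for the other frequency responses it is the usual mean-square extension. -/
def IsFilterOutput {Ω : Type*} [MeasurableSpace Ω] (P : Measure Ω) {L M : ℕ}
    (x : Fin M → ℝ → Ω → ℝ) (C : ℝ → Matrix (Fin M) (Fin M) ℂ)
    (F : ℝ → Matrix (Fin L) (Fin M) ℂ) (t : ℝ) (v : Fin L → Ω → ℝ) : Prop :=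
  (∀ l, MemLp (v l) 2 P) ∧
  ∃ h : ℕ → Fin L → Fin M → ℝ → ℝ,
    (∀ j l m, Integrable (h j l m)) ∧
    Tendsto (fun j => ∫⁻ f : ℝ, ENNReal.ofReal
      (trace ((freqResponse (h j) f - F f) * C f * (freqResponse (h j) f - F f)ᴴ)).re)
      atTop (𝓝 0) ∧
    ∀ l, Tendsto (fun j => eLpNorm (fun ω => conv (h j) x t l ω - v l ω) 2 P) atTop (𝓝 0)

/-- The minimum mean-square error estimate `E[s | {x m}]` of the task vector `s`. -/
def mmseEstimate {Ω : Type*} [MeasurableSpace Ω] (P : Measure Ω) {M N : ℕ}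
    (x : Fin M → ℝ → Ω → ℝ) (s : Fin N → Ω → ℝ) (i : Fin N) : Ω → ℝ :=
  P[s i | inputSigma x]

/-- Uniform sampling with period `Ts`: `y[n] = Ts * y(n Ts)`. -/
def sample {Ω : Type*} {K : ℕ} (y : Fin K → ℝ → Ω → ℝ) (Ts : ℝ) (n : ℤ) (k : Fin K) (ω : Ω) : ℝ :=
  Ts * y k (n * Ts) ω

/-- The step size `Δ = 2 γ / 2 ^ b` of a `b`-bit uniform quantizer with dynamic range `γ`. -/
def stepSize (b : ℕ) (γ : ℝ) : ℝ := 2 * γ / 2 ^ b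

/-- `w` is a dither process: independent and identically distributed in time and space, with the
triangular density of width `2 Δ`, and independent of the input process `x`. -/
structure IsDither {Ω : Type*} [MeasurableSpace Ω] (P : Measure Ω) {M K : ℕ}
    (x : Fin M → ℝ → Ω → ℝ) (Δ : ℝ) (w : ℤ → Fin K → Ω → ℝ) : Prop where
  measurable : ∀ n k, Measurable (w n k)
  law : ∀ n k, P.map (w n k) = volume.withDensity fun v : ℝ =>
    ENNReal.ofReal (if |v| ≤ Δ then 1 / Δ * (1 - |v| / Δ) else 0)
  iIndep : iIndepFun (fun p : ℤ × Fin K => w p.1 p.2) P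
  indep_input : Indep (⨆ p : ℤ × Fin K, MeasurableSpace.comap (w p.1 p.2) inferInstance)
    (inputSigma x) P

/-- The dynamic range rule `γ² = η² max_k E[(y_k[n] + w_k[n])²]`, with `γ > 0`; `y` is here the
sampled process. -/
def IsDynamicRange {Ω : Type*} [MeasurableSpace Ω] (P : Measure Ω) {K : ℕ}
    (η γ : ℝ) (y w : ℤ → Fin K → Ω → ℝ) : Prop :=
  0 < γ ∧ ∀ n, γ ^ 2 = η ^ 2 * ⨆ k, ∫ ω, (y n k ω + w n k ω) ^ 2 ∂P

/-- The `b`-bit uniform mid-rise quantization function with dynamic range `γ`. -/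
def quantizer (b : ℕ) (γ v : ℝ) : ℝ :=
  if |v| < γ then stepSize b γ * (⌊v / stepSize b γ⌋ + 1 / 2)
  else Real.sign v * (γ - stepSize b γ / 2)

/-- `z` is the output of the nonsubtractive dithered `b`-bit quantizers with dynamic range `γ` for
the sampled input `y` and the dither `w`, and the quantizers operate with zero overload
probability. -/
def IsDitheredOutput {Ω : Type*} [MeasurableSpace Ω] (P : Measure Ω) {K : ℕ}
    (b : ℕ) (γ : ℝ) (y w z : ℤ → Fin K → Ω → ℝ) : Prop :=
  (∀ n k, P {ω | γ ≤ |y n k ω + w n k ω|} = 0) ∧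
    ∀ n k ω, z n k ω = quantizer b γ (y n k ω + w n k ω)

/-- `z` is an output, for the sampled input `y`, of quantizers with step size `Δ` that follow the
equivalent additive model: the quantization error `e = z - y` has finite variance, is uncorrelated with `y`, and has the
autocorrelation `E[e[n + l] e[n]ᵀ] = (Δ² / 4) I δ[l]`. -/
structure IsAdditiveOutput {Ω : Type*} [MeasurableSpace Ω] (P : Measure Ω) {K : ℕ}
    (Δ : ℝ) (y z : ℤ → Fin K → Ω → ℝ) : Prop where
  memLp : ∀ n k, MemLp (z n k - y n k) 2 P
  uncorrelated : ∀ n n' k k', ∫ ω, (z n k ω - y n k ω) * y n' k' ω ∂P = 0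
  autocorrelation : ∀ n l k k', ∫ ω, (z (n + l) k ω - y (n + l) k ω) * (z n k' ω - y n k' ω) ∂P =
    if l = 0 ∧ k = k' then Δ ^ 2 / 4 else 0

/-- `shat` is the output `∑ n, G[-n] z[n]` of the linear digital filter `G`, the series converging
in mean square. -/
def IsDigitalEstimate {Ω : Type*} [MeasurableSpace Ω] (P : Measure Ω) {K N : ℕ}
    (z : ℤ → Fin K → Ω → ℝ) (G : ℤ → Matrix (Fin N) (Fin K) ℝ) (shat : Fin N → Ω → ℝ) : Prop :=
  ∀ i, MemLp (shat i) 2 P ∧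
    Tendsto (fun A : Finset ℤ =>
      eLpNorm (fun ω => shat i ω - ∑ n ∈ A, ∑ k, G (-n) i k * z n k ω) 2 P) atTop (𝓝 0)

/-- The minimum achievable mean-square error in the recovery of the random vector `st` from the
quantizer outputs `z` by linear digital filters: the infimum of `E[‖st - shat‖²]`. -/
def achievableMSE {Ω : Type*} [MeasurableSpace Ω] (P : Measure Ω) {K N : ℕ}
    (st : Fin N → Ω → ℝ) (z : ℤ → Fin K → Ω → ℝ) : ℝ :=
  sInf {r : ℝ | ∃ (G : ℤ → Matrix (Fin N) (Fin K) ℝ) (shat : Fin N → Ω → ℝ),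
    IsDigitalEstimate P z G shat ∧ r = ∫ ω, ∑ i, (st i ω - shat i ω) ^ 2 ∂P}

/-- The aliased cross-spectrum `S(f) = ∑ k, Γ(f - k fs) C(f - k fs) H(f - k fs)ᴴ`, `fs = 1 / Ts`. -/
def aliased {M L K : ℕ} (C : ℝ → Matrix (Fin M) (Fin M) ℂ) (Γ : ℝ → Matrix (Fin L) (Fin M) ℂ)
    (H : ℝ → Matrix (Fin K) (Fin M) ℂ) (Ts f : ℝ) : Matrix (Fin L) (Fin K) ℂ :=
  ∑' k : ℤ, Γ (f - k * (1 / Ts)) * C (f - k * (1 / Ts)) * (H (f - k * (1 / Ts)))ᴴ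

/-- The spectral density of the quantizer output,
`C_z(f) = Ts ∑ k, H(f - k fs) C(f - k fs) H(f - k fs)ᴴ + (Δ² / 4) I`. -/
def outputPSD {M K : ℕ} (C : ℝ → Matrix (Fin M) (Fin M) ℂ) (H : ℝ → Matrix (Fin K) (Fin M) ℂ)
    (Δ Ts f : ℝ) : Matrix (Fin K) (Fin K) ℂ :=
  (Ts : ℂ) • aliased C H H Ts f + ((Δ ^ 2 / 4 : ℝ) : ℂ) • (1 : Matrix (Fin K) (Fin K) ℂ)

/-- The closed-form expression of the achievable mean-square error,
`E[‖st‖²] - tr (Ts ∫ S(f) C_z(f)⁻¹ S(f)ᴴ df)`, the integral being over `[-fs / 2, fs / 2]`. -/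
def mseExpression {Ω : Type*} [MeasurableSpace Ω] (P : Measure Ω) {M N K : ℕ}
    (C : ℝ → Matrix (Fin M) (Fin M) ℂ) (Γ : ℝ → Matrix (Fin N) (Fin M) ℂ)
    (H : ℝ → Matrix (Fin K) (Fin M) ℂ) (st : Fin N → Ω → ℝ) (Δ Ts : ℝ) : ℝ :=
  (∫ ω, ∑ i, st i ω ^ 2 ∂P) -
    Ts * ∫ f in (-(1 / Ts) / 2)..((1 / Ts) / 2),
      (trace (aliased C Γ H Ts f * (outputPSD C H Δ Ts f)⁻¹ * (aliased C Γ H Ts f)ᴴ)).re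

/-- The block matrix `[F(f + υ fs) C(f + υ fs)^(1/2), …, F(f - υ fs) C(f - υ fs)^(1/2)]`, whose
blocks are `F(f - k fs) C(f - k fs)^(1/2)` for `k = -υ, …, υ`. -/
def stacked {M L : ℕ} (C : ℝ → Matrix (Fin M) (Fin M) ℂ) (F : ℝ → Matrix (Fin L) (Fin M) ℂ)
    (υ : ℕ) (Ts f : ℝ) : Matrix (Fin L) (Finset.Icc (-(υ : ℤ)) υ × Fin M) ℂ :=
  Matrix.of fun l p =>
    (F (f - (p.1 : ℤ) * (1 / Ts)) * CFC.sqrt (C (f - (p.1 : ℤ) * (1 / Ts)))) l p.2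

/-- The filter `H` maintains sufficiency with respect to the filter `Γ` at sampling period `Ts`:
for every `f` in `[-fs / 2, fs / 2]` the orthogonal projection onto the column space of the
conjugate transpose of the stacked matrix of `H` fixes the conjugate transpose of that of `Γ`, that
is, the column space of the latter is contained in that of the former. Where `Hbar * Hbarᴴ` is
invertible this is `Hbarᴴ * (Hbar * Hbarᴴ)⁻¹ * Hbar * Γbarᴴ = Γbarᴴ`. -/
def MaintainsSufficiency {M N K : ℕ} (C : ℝ → Matrix (Fin M) (Fin M) ℂ)
    (Γ : ℝ → Matrix (Fin N) (Fin M) ℂ) (H : ℝ → Matrix (Fin K) (Fin M) ℂ)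
    (υ : ℕ) (Ts : ℝ) : Prop :=
  ∀ f ∈ Set.Icc (-(1 / Ts) / 2) ((1 / Ts) / 2),
    LinearMap.range (stacked C Γ υ Ts f)ᴴ.mulVecLin ≤
      LinearMap.range (stacked C H υ Ts f)ᴴ.mulVecLin

end

end TaskADC

/-! Two facts drive the proof. First, for each fixed `f` a small enough period puts `f` in the
baseband, and the central block of the sufficiency condition gives `Γ C^(1/2) = A H C^(1/2)` at `f`
for some matrix `A = A(f)` (`exists_mul_eq_of_sufficiency`); neither measurability nor a bound for
`A` in `f` is needed. Second, the samples `Ts * y(n Ts)` have size of order `Ts`, and the dynamic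
range rule makes `Δ` of order `Ts` as well (`stepSize_sq_le_or`), unless the filter output vanishes.
Thus the noise per sample is comparable to the signal, but the number of samples per unit time grows
like `1 / Ts`, and the effective noise density `δ = Δ² / (4 Ts)` tends to zero.

For the closed form, aliasing disappears once `B < fs / 2`, and with `W = H C Hᴴ` the expression
becomes the integral of `tr (A (W - W (W + δ)⁻¹ W) Aᴴ)`. By `resolvent_bounds` the integrand lies
between `0` and the integrable function `tr (Γ C Γᴴ)`, and is at most `δ tr (A Aᴴ)`, so dominated
convergence applies (`tendsto_mseExpression`).

The achievable MSE is treated directly, without proving it equal to the closed form. Filter outputs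
have the same Gram matrix as the rows `F C^(1/2) exp(2πift)` in `L²(df)`
(`IsFilterOutput.inner_eq`). A vector orthogonal to all modulations of the rows of `H` is, by
uniqueness of the Fourier transform, orthogonal to them at almost every frequency, hence to the rows
of `Γ`; so the MMSE estimate lies in the closed real span of the variables `y_k(t)`
(`IsFilterOutput.mem_closure_span`). Each `y_k(t)` is in turn approximated by averaging the
quantized samples over a short window after `t`: mean-square continuity controls the bias, and
errors uncorrelated in time average out (`recoverable_of_samples`). The vectors that can be so
approximated form a closed subspace, which finishes the argument. -/

namespace TaskADC

noncomputable section

/-! ### Square roots of the spectral density and the pointwise factorization. -/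

section

open scoped Matrix.Norms.L2Operator

theorem continuousOn_matrix_sqrt {M : ℕ} :
    ContinuousOn (CFC.sqrt : Matrix (Fin M) (Fin M) ℂ → Matrix (Fin M) (Fin M) ℂ) {a | 0 ≤ a} :=
  CFC.continuousOn_sqrt

theorem isClosed_matrix_nonneg {M : ℕ} : IsClosed {a : Matrix (Fin M) (Fin M) ℂ | 0 ≤ a} :=
  CStarAlgebra.isClosed_nonneg

end

/-- The square root is continuous on the cone of positive semidefinite matrices, which is closed, so
its extension by zero is Borel; `C` takes values in the cone only. -/
theorem aemeasurable_sqrt_apply {M : ℕ} {C : ℝ → Matrix (Fin M) (Fin M) ℂ}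
    (hC : ∀ f, (C f).PosSemidef) (hm : ∀ i j, AEMeasurable (fun f => C f i j)) (i j : Fin M) :
    AEMeasurable (fun f => CFC.sqrt (C f) i j) := by
  classical
  let s : Set (Fin M → Fin M → ℂ) := {a | (0 : Matrix (Fin M) (Fin M) ℂ) ≤ Matrix.of a}
  have hs : IsClosed s := isClosed_matrix_nonneg
  let g : (Fin M → Fin M → ℂ) → ℂ := s.piecewise (fun a => CFC.sqrt (Matrix.of a) i j) 0
  have hg : Measurable g := by
    refine ContinuousOn.measurable_piecewise ?_ continuousOn_const hs.measurableSet
    have h1 : Continuous fun a : Matrix (Fin M) (Fin M) ℂ => a i j := by fun_prop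
    exact h1.comp_continuousOn (continuousOn_matrix_sqrt (M := M))
  have hm' : AEMeasurable (fun f => (fun i j => C f i j : Fin M → Fin M → ℂ)) :=
    aemeasurable_pi_lambda _ fun i => aemeasurable_pi_lambda _ fun j => hm i j
  refine (hg.comp_aemeasurable hm').congr (Eventually.of_forall fun f => ?_)
  have : (fun i j => C f i j : Fin M → Fin M → ℂ) ∈ s := (hC f).nonneg
  simp only [g, Function.comp_apply, Set.piecewise_eq_of_mem _ _ _ this]
  rfl

/-- The `l`-th row of `F(f) C(f)^(1/2)`, as a vector of a Hilbert space. -/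
def halfRow {M L : ℕ} (C : ℝ → Matrix (Fin M) (Fin M) ℂ) (F : ℝ → Matrix (Fin L) (Fin M) ℂ)
    (l : Fin L) (f : ℝ) : EuclideanSpace ℂ (Fin M) :=
  WithLp.toLp 2 ((F f * CFC.sqrt (C f)) l)

theorem halfRow_apply {M L : ℕ} (C : ℝ → Matrix (Fin M) (Fin M) ℂ)
    (F : ℝ → Matrix (Fin L) (Fin M) ℂ) (l : Fin L) (f : ℝ) (m : Fin M) :
    halfRow C F l f m = (F f * CFC.sqrt (C f)) l m := rfl

theorem half_mul_half_conjTranspose {M L L' : ℕ} {c : Matrix (Fin M) (Fin M) ℂ}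
    (hC : c.PosSemidef) (F : Matrix (Fin L) (Fin M) ℂ) (G : Matrix (Fin L') (Fin M) ℂ) :
    (F * CFC.sqrt c) * (G * CFC.sqrt c)ᴴ = F * c * Gᴴ := by
  have h1 : (CFC.sqrt c)ᴴ = CFC.sqrt c := (CFC.sqrt_nonneg c).posSemidef.isHermitian
  have h2 : CFC.sqrt c * CFC.sqrt c = c := CFC.sqrt_mul_sqrt_self c hC.nonneg
  rw [Matrix.conjTranspose_mul, h1, Matrix.mul_assoc, ← Matrix.mul_assoc (CFC.sqrt c), h2,
    ← Matrix.mul_assoc]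

theorem inner_halfRow {M L L' : ℕ} {C : ℝ → Matrix (Fin M) (Fin M) ℂ}
    (hC : ∀ f, (C f).PosSemidef) (F : ℝ → Matrix (Fin L) (Fin M) ℂ)
    (G : ℝ → Matrix (Fin L') (Fin M) ℂ) (l : Fin L) (l' : Fin L') (f : ℝ) :
    inner ℂ (halfRow C G l' f) (halfRow C F l f) = (F f * C f * (G f)ᴴ) l l' := by
  rw [← half_mul_half_conjTranspose (hC f), PiLp.inner_apply, Matrix.mul_apply]
  refine Finset.sum_congr rfl fun m _ => ?_
  simp [halfRow_apply, Matrix.conjTranspose_apply]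

theorem norm_sq_halfRow {M L : ℕ} {C : ℝ → Matrix (Fin M) (Fin M) ℂ}
    (hC : ∀ f, (C f).PosSemidef) (F : ℝ → Matrix (Fin L) (Fin M) ℂ) (l : Fin L) (f : ℝ) :
    ‖halfRow C F l f‖ ^ 2 = ((F f * C f * (F f)ᴴ) l l).re := by
  rw [← inner_halfRow hC, inner_self_eq_norm_sq_to_K]
  norm_cast

theorem sum_norm_sq_halfRow {M L : ℕ} {C : ℝ → Matrix (Fin M) (Fin M) ℂ}
    (hC : ∀ f, (C f).PosSemidef) (F : ℝ → Matrix (Fin L) (Fin M) ℂ) (f : ℝ) :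
    ∑ l, ‖halfRow C F l f‖ ^ 2 = (trace (F f * C f * (F f)ᴴ)).re := by
  simp only [norm_sq_halfRow hC, Matrix.trace, Matrix.diag_apply, Complex.re_sum]

theorem halfRow_sub {M L : ℕ} (C : ℝ → Matrix (Fin M) (Fin M) ℂ)
    (F G : ℝ → Matrix (Fin L) (Fin M) ℂ) (l : Fin L) (f : ℝ) :
    halfRow C (fun f => F f - G f) l f = halfRow C F l f - halfRow C G l f := by
  ext m
  simp [halfRow_apply, Matrix.sub_mul]

theorem aestronglyMeasurable_halfRow {M L : ℕ} {C : ℝ → Matrix (Fin M) (Fin M) ℂ}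
    (hC : ∀ f, (C f).PosSemidef) (hm : ∀ i j, AEMeasurable (fun f => C f i j))
    {F : ℝ → Matrix (Fin L) (Fin M) ℂ} (hF : ∀ l m, AEMeasurable (fun f => F f l m)) (l : Fin L) :
    AEStronglyMeasurable (halfRow C F l) := by
  have h : AEMeasurable (fun f => (F f * CFC.sqrt (C f)) l) := by
    refine aemeasurable_pi_lambda _ fun m => ?_
    simp only [Matrix.mul_apply]
    exact Finset.aemeasurable_fun_sum _ fun k _ => (hF l k).mul (aemeasurable_sqrt_apply hC hm k m)
  exact ((WithLp.measurable_toLp 2 _).comp_aemeasurable h).aestronglyMeasurable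

/-- Sufficiency at all small sampling periods makes the weighted response of the estimator a left
multiple of the weighted response of the analog filter, at every frequency. -/
theorem exists_mul_eq_of_sufficiency {M N K : ℕ} {C : ℝ → Matrix (Fin M) (Fin M) ℂ}
    {Γ : ℝ → Matrix (Fin N) (Fin M) ℂ} {H : ℝ → Matrix (Fin K) (Fin M) ℂ} {υ : ℕ}
    (hsuff : ∀ᶠ Ts : ℝ in 𝓝[>] 0, MaintainsSufficiency C Γ H υ Ts) (f : ℝ) :
    ∃ A : Matrix (Fin N) (Fin K) ℂ,
      Γ f * CFC.sqrt (C f) = A * (H f * CFC.sqrt (C f)) := by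
  have h1 : ∀ᶠ Ts : ℝ in 𝓝[>] 0, |f| ≤ (1 / Ts) / 2 := by
    have : Tendsto (fun Ts : ℝ => (1 / Ts) / 2) (𝓝[>] 0) atTop := by
      simp only [one_div]
      exact tendsto_inv_nhdsGT_zero.atTop_div_const two_pos
    exact this.eventually_ge_atTop _
  obtain ⟨Ts, hTs, hf⟩ := (hsuff.and h1).exists
  have hr := hTs f ⟨by linarith [neg_abs_le f], (le_abs_self f).trans hf⟩
  have key : ∀ n, ∃ a : Fin K → ℂ, ∀ m, (Γ f * CFC.sqrt (C f)) n m =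
      ∑ k, a k * (H f * CFC.sqrt (C f)) k m := by
    intro n
    obtain ⟨u, hu⟩ := hr ⟨Pi.single n 1, rfl⟩
    refine ⟨star u, fun m => ?_⟩
    -- Only the unshifted block `k = 0` of the stacked matrices is used.
    have h0 : (0 : ℤ) ∈ Finset.Icc (-(υ : ℤ)) υ := by simp
    have := congrFun hu (⟨0, h0⟩, m)
    simp only [Matrix.mulVecLin_apply, Matrix.mulVec, dotProduct,
      Matrix.conjTranspose_apply, stacked, Matrix.of_apply] at this
    have h2 := congrArg star this
    simp only [star_sum, star_mul', star_star, Int.cast_zero, zero_mul, sub_zero] at h2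
    have h3 : ∑ i, (Γ f * CFC.sqrt (C f)) i m * star ((Pi.single n 1 : Fin N → ℂ) i) =
        (Γ f * CFC.sqrt (C f)) n m := by
      rw [Finset.sum_eq_single n] <;> simp +contextual
    rw [h3] at h2
    refine h2.symm.trans ?_
    exact Finset.sum_congr rfl fun k _ => mul_comm _ _
  choose A hA using key
  refine ⟨Matrix.of A, ?_⟩
  ext n m
  rw [hA, Matrix.mul_apply (M := Matrix.of A)]
  rfl

/-! ### Exponentials and Fourier integrals. -/

/-- The complex exponential `exp (2 π i f t)`. -/
def expi (f t : ℝ) : ℂ := Complex.exp (2 * Real.pi * Complex.I * f * t)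

theorem expi_eq (f t : ℝ) : expi f t = Complex.exp ((2 * Real.pi * f * t : ℝ) * Complex.I) := by
  rw [expi]; congr 1; push_cast; ring

theorem norm_expi (f t : ℝ) : ‖expi f t‖ = 1 := by
  rw [expi_eq, Complex.norm_exp_ofReal_mul_I]

theorem expi_add (f s t : ℝ) : expi f (s + t) = expi f s * expi f t := by
  simp only [expi, ← Complex.exp_add]; congr 1; push_cast; ring

theorem conj_expi (f t : ℝ) : (starRingEnd ℂ) (expi f t) = expi f (-t) := by
  rw [expi, ← Complex.exp_conj, expi]
  congr 1
  simp [map_ofNat]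

theorem expi_zero (f : ℝ) : expi f 0 = 1 := by simp [expi]

theorem continuous_expi : Continuous (fun p : ℝ × ℝ => expi p.1 p.2) := by
  unfold expi; fun_prop

theorem fourier_eq_integral_expi (h : ℝ → ℂ) (f : ℝ) : 𝓕 h f = ∫ τ, h τ * expi f (-τ) := by
  rw [Real.fourier_eq']
  refine integral_congr_ae (Eventually.of_forall fun τ => ?_)
  simp only [smul_eq_mul, expi_eq]
  rw [mul_comm]
  congr 3
  simp
  ring

theorem norm_fourier_le (h : ℝ → ℂ) (f : ℝ) : ‖𝓕 h f‖ ≤ ∫ τ, ‖h τ‖ := by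
  rw [fourier_eq_integral_expi]
  refine (norm_integral_le_integral_norm _).trans (le_of_eq ?_)
  simp [norm_expi]

theorem continuous_fourier {h : ℝ → ℂ} (hh : Integrable h) : Continuous (𝓕 h) :=
  VectorFourier.fourierIntegral_continuous Real.continuous_fourierChar (by fun_prop) hh

theorem integrable_mul_expi {g : ℝ → ℂ} (hg : Integrable g) (t : ℝ) :
    Integrable fun f => g f * expi f t := by
  refine hg.mul_bdd (c := 1) ?_ (Eventually.of_forall fun f => (norm_expi f t).le)
  exact (continuous_expi.comp (by fun_prop : Continuous fun f : ℝ => (f, t))).aestronglyMeasurable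

theorem integrable_mul_fourier {g h : ℝ → ℂ} (hg : Integrable g) (hh : Integrable h) :
    Integrable fun f => g f * 𝓕 h f :=
  hg.mul_bdd (continuous_fourier hh).aestronglyMeasurable
    (Eventually.of_forall fun f => norm_fourier_le h f)

/-- Averaging the inverse Fourier integral of `g` against `h` multiplies `g` by the Fourier
transform of `h`. -/
theorem integral_mul_integral_expi {g h : ℝ → ℂ} (hg : Integrable g) (hh : Integrable h) (t : ℝ) :
    ∫ τ, h τ * ∫ f, g f * expi f (t - τ) = ∫ f, g f * 𝓕 h f * expi f t := by
  simp only [← integral_const_mul]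
  rw [integral_integral_swap]
  · refine integral_congr_ae (Eventually.of_forall fun f => ?_)
    simp only [fourier_eq_integral_expi, sub_eq_add_neg, expi_add]
    rw [mul_right_comm, ← integral_const_mul]
    refine integral_congr_ae (Eventually.of_forall fun τ => ?_)
    simp only
    ring
  · have h1 : Integrable (fun p : ℝ × ℝ => h p.1 * g p.2) (volume.prod volume) := hh.mul_prod hg
    have h2 : Continuous fun p : ℝ × ℝ => expi p.2 (t - p.1) :=
      continuous_expi.comp (by fun_prop : Continuous fun p : ℝ × ℝ => (p.2, t - p.1))
    have := h1.mul_bdd (c := 1) h2.aestronglyMeasurable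
      (Eventually.of_forall fun p => (norm_expi _ _).le)
    refine this.congr (Eventually.of_forall fun p => ?_)
    simp only [Function.uncurry]
    ring

/-! ### Second moments of scalar convolutions. -/

section Fubini

variable {Ω : Type*} [MeasurableSpace Ω] {P : Measure Ω}

theorem integral_norm_mul_le {X Y : Ω → ℝ} (hX : MemLp X 2 P) (hY : MemLp Y 2 P) :
    ∫ ω, ‖X ω * Y ω‖ ∂P ≤ (∫ ω, X ω ^ 2 ∂P) + ∫ ω, Y ω ^ 2 ∂P := by
  rw [← integral_add hX.integrable_sq hY.integrable_sq]
  refine integral_mono_of_nonneg (Eventually.of_forall fun ω => norm_nonneg _)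
    (hX.integrable_sq.add hY.integrable_sq) (Eventually.of_forall fun ω => ?_)
  simp only [norm_mul, Real.norm_eq_abs]
  nlinarith [sq_nonneg (|X ω| - |Y ω|), sq_abs (X ω), sq_abs (Y ω), sq_nonneg (|X ω| + |Y ω|)]

variable {M : ℕ} {x : Fin M → ℝ → Ω → ℝ} {C : ℝ → Matrix (Fin M) (Fin M) ℂ}

theorem IsWSS.integral_sq (hx : IsWSS P x C) (m : Fin M) (t : ℝ) :
    ∫ ω, x m t ω ^ 2 ∂P = ∫ ω, x m 0 ω ^ 2 ∂P := by
  have h1 := hx.correlation m m t 0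
  have h2 := hx.correlation m m 0 0
  rw [← h2] at h1
  simpa [pow_two] using h1

theorem IsWSS.measurable_comp (hx : IsWSS P x C) (m : Fin M) {α : Type*} [MeasurableSpace α]
    {u : α → ℝ} (hu : Measurable u) :
    Measurable fun p : Ω × α => x m (u p.2) p.1 :=
  (hx.measurable m).comp ((hu.comp measurable_snd).prodMk measurable_fst)

/-- The scalar convolution integral `∫ h(τ) x_m(t - τ) dτ`. -/
def scalarConv (x : Fin M → ℝ → Ω → ℝ) (h : ℝ → ℝ) (m : Fin M) (t : ℝ) (ω : Ω) : ℝ :=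
  ∫ τ, h τ * x m (t - τ) ω

theorem IsWSS.aestronglyMeasurable_scalarConv [SFinite P] (hx : IsWSS P x C) {h : ℝ → ℝ} (hh : Integrable h)
    (m : Fin M) (t : ℝ) : AEStronglyMeasurable (scalarConv x h m t) P := by
  have : AEStronglyMeasurable (fun p : Ω × ℝ => h p.2 * x m (t - p.2) p.1) (P.prod volume) :=
    hh.aestronglyMeasurable.comp_snd.mul
      (hx.measurable_comp m (measurable_id.const_sub t)).aestronglyMeasurable
  exact this.integral_prod_right'

theorem IsWSS.integral_mul_eq (hx : IsWSS P x C) (i j : Fin M) (s t : ℝ) :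
    ((∫ ω, x j s ω * x i t ω ∂P : ℝ) : ℂ) = ∫ f, C f i j * expi f (-s) * expi f t := by
  have h := hx.correlation i j s (t - s)
  rw [add_sub_cancel] at h
  simp only [mul_comm (x j s _), h]
  refine integral_congr_ae (Eventually.of_forall fun f => ?_)
  have h1 := expi_add f (-s) t
  rw [neg_add_eq_sub] at h1
  change C f i j * expi f (t - s) = _
  rw [h1]
  ring

variable [IsProbabilityMeasure P]

/-- Tonelli with the integral over `Ω` taken first: it is bounded uniformly in `a`, and the kernel
`k` is integrable. This justifies every exchange of expectation and convolution below. -/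
theorem integrable_prod_of_bound {α : Type*} [MeasurableSpace α] {μ : Measure α} [SFinite μ]
    {k : α → ℝ} (hk : Integrable k μ) {Φ : Ω × α → ℝ} (hm : AEStronglyMeasurable Φ (P.prod μ))
    (hi : ∀ a, Integrable (fun ω => Φ (ω, a)) P) {c : ℝ} (hc : ∀ a, ∫ ω, ‖Φ (ω, a)‖ ∂P ≤ c) :
    Integrable (fun p : Ω × α => k p.2 * Φ p) (P.prod μ) := by
  have hm' : AEStronglyMeasurable (fun p : Ω × α => k p.2 * Φ p) (P.prod μ) :=
    (hk.aestronglyMeasurable.comp_snd).mul hm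
  rw [integrable_prod_iff' hm']
  refine ⟨Eventually.of_forall fun a => (hi a).const_mul (k a), ?_⟩
  refine (hk.norm.mul_const c).mono' hm'.norm.prod_swap.integral_prod_right' ?_
  refine Eventually.of_forall fun a => ?_
  rw [Real.norm_of_nonneg (integral_nonneg fun ω => norm_nonneg _)]
  simp only [norm_mul]
  rw [integral_const_mul]
  exact mul_le_mul_of_nonneg_left (hc a) (norm_nonneg _)

theorem IsWSS.memLp_scalarConv (hx : IsWSS P x C) {h : ℝ → ℝ} (hh : Integrable h)
    (m : Fin M) (t : ℝ) : MemLp (scalarConv x h m t) 2 P := by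
  rw [memLp_two_iff_integrable_sq (hx.aestronglyMeasurable_scalarConv hh m t)]
  -- The square of the convolution is a double integral over two delays; stationarity bounds the
  -- moments uniformly in both.
  have h1 : Integrable (fun p : Ω × (ℝ × ℝ) => (h p.2.1 * h p.2.2) *
      (x m (t - p.2.1) p.1 * x m (t - p.2.2) p.1)) (P.prod (volume.prod volume)) := by
    refine integrable_prod_of_bound (k := fun a : ℝ × ℝ => h a.1 * h a.2)
      (Φ := fun p : Ω × (ℝ × ℝ) => x m (t - p.2.1) p.1 * x m (t - p.2.2) p.1)
      (c := (∫ ω, x m 0 ω ^ 2 ∂P) + ∫ ω, x m 0 ω ^ 2 ∂P) (hh.mul_prod hh) ?_ ?_ ?_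
    · exact ((hx.measurable_comp m (measurable_fst.const_sub t)).mul
        (hx.measurable_comp m (measurable_snd.const_sub t))).aestronglyMeasurable
    · exact fun a => (hx.memLp m (t - a.1)).integrable_mul (hx.memLp m (t - a.2))
    · intro a
      refine (integral_norm_mul_le (hx.memLp m (t - a.1)) (hx.memLp m (t - a.2))).trans (le_of_eq ?_)
      rw [hx.integral_sq m (t - a.1), hx.integral_sq m (t - a.2)]
  refine h1.integral_prod_left.congr (Eventually.of_forall fun ω => ?_)
  have := integral_prod_mul (μ := (volume : Measure ℝ)) (ν := (volume : Measure ℝ))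
    (fun τ => h τ * x m (t - τ) ω) (fun τ => h τ * x m (t - τ) ω)
  simp only [scalarConv, pow_two, ← this]
  refine integral_congr_ae (Eventually.of_forall fun a => ?_)
  simp only
  ring

/-- Correlation with a convolution integral is the convolution of the correlations. -/
theorem IsWSS.integral_mul_scalarConv (hx : IsWSS P x C) {W : Ω → ℝ} (hW : MemLp W 2 P)
    {h : ℝ → ℝ} (hh : Integrable h) (m : Fin M) (t : ℝ) :
    ∫ ω, W ω * scalarConv x h m t ω ∂P = ∫ τ, h τ * ∫ ω, W ω * x m (t - τ) ω ∂P := by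
  have h1 : Integrable (fun p : Ω × ℝ => h p.2 * (W p.1 * x m (t - p.2) p.1))
      (P.prod volume) := by
    refine integrable_prod_of_bound (Φ := fun p : Ω × ℝ => W p.1 * x m (t - p.2) p.1)
      (c := (∫ ω, W ω ^ 2 ∂P) + ∫ ω, x m 0 ω ^ 2 ∂P) hh ?_ ?_ ?_
    · exact hW.aestronglyMeasurable.comp_fst.mul
        (hx.measurable_comp m (measurable_id.const_sub t)).aestronglyMeasurable
    · exact fun a => hW.integrable_mul (hx.memLp m (t - a))
    · intro a
      refine (integral_norm_mul_le hW (hx.memLp m (t - a))).trans (le_of_eq ?_)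
      rw [hx.integral_sq m (t - a)]
  simp only [scalarConv, ← integral_const_mul]
  rw [integral_integral_swap]
  · refine integral_congr_ae (Eventually.of_forall fun τ => ?_)
    refine integral_congr_ae (Eventually.of_forall fun ω => ?_)
    simp only
    ring
  · refine h1.congr (Eventually.of_forall fun p => ?_)
    simp only [Function.uncurry]
    ring

/-- If `g` is the cross-spectrum of `W` and `x m`, then `g` times the frequency response of `h` is
the cross-spectrum of `W` and the output of `h`. -/
theorem IsWSS.integral_mul_scalarConv_eq (hx : IsWSS P x C) {W : Ω → ℝ} (hW : MemLp W 2 P)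
    {h : ℝ → ℝ} (hh : Integrable h) (m : Fin M) {g : ℝ → ℂ} (hg : Integrable g)
    (hWx : ∀ s, ((∫ ω, W ω * x m s ω ∂P : ℝ) : ℂ) = ∫ f, g f * expi f s) (t : ℝ) :
    ((∫ ω, W ω * scalarConv x h m t ω ∂P : ℝ) : ℂ) =
      ∫ f, g f * 𝓕 (fun τ => (h τ : ℂ)) f * expi f t := by
  rw [hx.integral_mul_scalarConv hW hh, ← integral_complex_ofReal]
  push_cast
  simp only [hWx]
  exact integral_mul_integral_expi hg hh.ofReal t

/-- The one-sided formula is used twice: with `W = x j s` it gives the cross-spectrum of the first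
output and `x j`, up to a conjugation that is harmless because correlations are real; then `W` is
the first output itself. -/
theorem IsWSS.integral_scalarConv_mul_scalarConv (hx : IsWSS P x C) {h h' : ℝ → ℝ}
    (hh : Integrable h) (hh' : Integrable h') (i j : Fin M) (t t' : ℝ) :
    ((∫ ω, scalarConv x h i t ω * scalarConv x h' j t' ω ∂P : ℝ) : ℂ) =
      ∫ f, (starRingEnd ℂ) (C f i j * 𝓕 (fun τ => (h τ : ℂ)) f * expi f t) *
        𝓕 (fun τ => (h' τ : ℂ)) f * expi f t' := by
  have hI : Integrable fun f => C f i j * 𝓕 (fun τ => (h τ : ℂ)) f :=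
    integrable_mul_fourier (hx.integrable i j) hh.ofReal
  refine hx.integral_mul_scalarConv_eq (hx.memLp_scalarConv hh i t) hh' j ?_ ?_ t'
  · exact (Complex.conjLIE.toContinuousLinearEquiv.toContinuousLinearMap.integrable_comp
      (integrable_mul_expi hI t) :)
  · intro s
    have h1 := hx.integral_mul_scalarConv_eq (hx.memLp j s) hh i
      (integrable_mul_expi (hx.integrable i j) (-s)) (hx.integral_mul_eq i j s) t
    have h2 := congrArg (starRingEnd ℂ) h1
    rw [Complex.conj_ofReal, ← integral_conj] at h2
    simp only [mul_comm (scalarConv x h i t _), h2]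
    refine integral_congr_ae (Eventually.of_forall fun f => ?_)
    simp only [map_mul, conj_expi, neg_neg]
    ring

end Fubini

/-! ### Spectral representatives in `L²(df)`. -/

theorem inner_toLp {𝕜 α F : Type*} [RCLike 𝕜] [MeasurableSpace α] {μ : Measure α}
    [NormedAddCommGroup F] [InnerProductSpace 𝕜 F] {f g : α → F} (hf : MemLp f 2 μ)
    (hg : MemLp g 2 μ) : inner 𝕜 (hf.toLp f) (hg.toLp g) = ∫ a, inner 𝕜 (f a) (g a) ∂μ := by
  rw [L2.inner_def]
  refine integral_congr_ae ?_
  filter_upwards [hf.coeFn_toLp, hg.coeFn_toLp] with a h1 h2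
  rw [h1, h2]

theorem integrable_mul_of_memLp {α : Type*} [MeasurableSpace α] {μ : Measure α} {f g : α → ℝ}
    (hf : MemLp f 2 μ) (hg : MemLp g 2 μ) : Integrable (fun a => f a * g a) μ :=
  hf.integrable_mul hg

theorem real_inner_toLp {α : Type*} [MeasurableSpace α] {μ : Measure α} {f g : α → ℝ}
    (hf : MemLp f 2 μ) (hg : MemLp g 2 μ) :
    inner ℝ (hf.toLp f) (hg.toLp g) = ∫ a, f a * g a ∂μ := by
  rw [inner_toLp]
  refine integral_congr_ae (Eventually.of_forall fun a => ?_)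
  simp [mul_comm]

/-- The `l`-th row of `F(f) C(f)^(1/2) exp(2 π i f t)`: the spectral representative of the `l`-th
output at time `t` of the filter `F`. -/
def specRow {M L : ℕ} (C : ℝ → Matrix (Fin M) (Fin M) ℂ) (F : ℝ → Matrix (Fin L) (Fin M) ℂ)
    (l : Fin L) (t f : ℝ) : EuclideanSpace ℂ (Fin M) :=
  expi f t • halfRow C F l f

section Spectral

variable {M L L' : ℕ} {C : ℝ → Matrix (Fin M) (Fin M) ℂ}

theorem inner_specRow (hC : ∀ f, (C f).PosSemidef) (F : ℝ → Matrix (Fin L) (Fin M) ℂ)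
    (G : ℝ → Matrix (Fin L') (Fin M) ℂ) (l : Fin L) (l' : Fin L') (t t' f : ℝ) :
    inner ℂ (specRow C F l t f) (specRow C G l' t' f) =
      expi f (t' - t) * (G f * C f * (F f)ᴴ) l' l := by
  rw [specRow, specRow, inner_smul_left, inner_smul_right, inner_halfRow hC, conj_expi,
    sub_eq_add_neg, expi_add]
  ring

theorem norm_specRow (F : ℝ → Matrix (Fin L) (Fin M) ℂ) (l : Fin L) (t f : ℝ) :
    ‖specRow C F l t f‖ = ‖halfRow C F l f‖ := by
  rw [specRow, norm_smul, norm_expi, one_mul]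

theorem specRow_sub (F G : ℝ → Matrix (Fin L) (Fin M) ℂ) (l : Fin L) (t f : ℝ) :
    specRow C (fun f => F f - G f) l t f = specRow C F l t f - specRow C G l t f := by
  rw [specRow, halfRow_sub, smul_sub, specRow, specRow]

theorem aestronglyMeasurable_specRow (hC : ∀ f, (C f).PosSemidef)
    (hm : ∀ i j, AEMeasurable (fun f => C f i j))
    {F : ℝ → Matrix (Fin L) (Fin M) ℂ} (hF : ∀ l m, AEMeasurable (fun f => F f l m)) (l : Fin L)
    (t : ℝ) : AEStronglyMeasurable (specRow C F l t) :=
  (continuous_expi.comp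
    (by fun_prop : Continuous fun f : ℝ => (f, t))).aestronglyMeasurable.smul
      (aestronglyMeasurable_halfRow hC hm hF l)

theorem mul_mul_conjTranspose_apply (c : Matrix (Fin M) (Fin M) ℂ) (F : Matrix (Fin L) (Fin M) ℂ)
    (G : Matrix (Fin L') (Fin M) ℂ) (l : Fin L) (l' : Fin L') :
    (F * c * Gᴴ) l l' = ∑ j, ∑ i, F l i * c i j * star (G l' j) := by
  simp only [Matrix.mul_apply, Matrix.conjTranspose_apply, Finset.sum_mul]

theorem continuous_freqResponse {h : Fin L → Fin M → ℝ → ℝ} (hh : ∀ l m, Integrable (h l m))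
    (l : Fin L) (m : Fin M) : Continuous fun f => freqResponse h f l m :=
  continuous_fourier (hh l m).ofReal

theorem integrable_freqResponse_mul (hC : ∀ i j, Integrable fun f => C f i j)
    {h : Fin L → Fin M → ℝ → ℝ} (hh : ∀ l m, Integrable (h l m))
    {h' : Fin L' → Fin M → ℝ → ℝ} (hh' : ∀ l m, Integrable (h' l m)) (l : Fin L) (l' : Fin L')
    (i j : Fin M) :
    Integrable fun f => freqResponse h f l i * C f i j * star (freqResponse h' f l' j) := by
  have h1 : Integrable fun f => freqResponse h f l i * C f i j :=
    (integrable_mul_fourier (hC i j) (hh l i).ofReal).congr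
      (Eventually.of_forall fun f => mul_comm _ _)
  refine h1.mul_bdd (c := ∫ τ, ‖((h' l' j τ : ℝ) : ℂ)‖) ?_ (Eventually.of_forall fun f => ?_)
  · exact (continuous_freqResponse hh' l' j).star.aestronglyMeasurable
  · rw [norm_star]
    exact norm_fourier_le _ f

theorem memLp_specRow_freqResponse (hC : ∀ f, (C f).PosSemidef)
    (hi : ∀ i j, Integrable fun f => C f i j)
    {h : Fin L → Fin M → ℝ → ℝ} (hh : ∀ l m, Integrable (h l m)) (l : Fin L) (t : ℝ) :
    MemLp (specRow C (freqResponse h) l t) 2 := by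
  rw [memLp_two_iff_integrable_sq_norm (aestronglyMeasurable_specRow hC
    (fun i j => (hi i j).aemeasurable)
    (fun l m => (continuous_freqResponse hh l m).measurable.aemeasurable) l t)]
  simp only [norm_specRow, norm_sq_halfRow hC, mul_mul_conjTranspose_apply]
  exact (integrable_finsetSum _ fun j _ => integrable_finsetSum _ fun i _ =>
    integrable_freqResponse_mul hi hh hh l l i j).re

end Spectral

theorem conv_eq_sum {Ω : Type*} {M L : ℕ} (x : Fin M → ℝ → Ω → ℝ) (h : Fin L → Fin M → ℝ → ℝ) (t : ℝ) (l : Fin L) :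
    conv h x t l = fun ω => ∑ m, scalarConv x (h l m) m t ω := rfl

/-! ### The isometry between filter outputs and spectral representatives. -/

section Gram

variable {Ω : Type*} [MeasurableSpace Ω] {P : Measure Ω} {M L L' : ℕ}
  {x : Fin M → ℝ → Ω → ℝ} {C : ℝ → Matrix (Fin M) (Fin M) ℂ}

theorem tendsto_eLpNorm_two_of_tendsto_lintegral {α F : Type*} [MeasurableSpace α] {μ : Measure α}
    [NormedAddCommGroup F] {u : ℕ → α → F}
    (h : Tendsto (fun j => ∫⁻ a, ENNReal.ofReal (‖u j a‖ ^ 2) ∂μ) atTop (𝓝 0)) :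
    Tendsto (fun j => eLpNorm (u j) 2 μ) atTop (𝓝 0) := by
  have h1 : ∀ j, eLpNorm (u j) 2 μ = (∫⁻ a, ENNReal.ofReal (‖u j a‖ ^ 2) ∂μ) ^ (1 / 2 : ℝ) := by
    intro j
    rw [eLpNorm_eq_lintegral_rpow_enorm_toReal two_ne_zero ENNReal.ofNat_ne_top]
    simp only [ENNReal.toReal_ofNat]
    congr 1
    refine lintegral_congr fun a => ?_
    rw [ENNReal.ofReal_pow (norm_nonneg _), ofReal_norm]
    norm_cast
  simp only [h1]
  have := h.ennrpow_const (1 / 2)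
  simpa using this

/-- The trace in `IsFilterOutput` is the sum over `l` of the squared distances of the spectral rows,
so one sequence of impulse responses approximates rows and outputs together. The rows of `F` are
square integrable because they are at finite distance from rows of integrable filters. -/
theorem IsFilterOutput.exists_approx (hx : IsWSS P x C) {F : ℝ → Matrix (Fin L) (Fin M) ℂ}
    (hF : ∀ l m, Measurable fun f => F f l m) {t : ℝ} {v : Fin L → Ω → ℝ}
    (hv : IsFilterOutput P x C F t v) :
    (∀ l, MemLp (specRow C F l t) 2) ∧ ∃ h : ℕ → Fin L → Fin M → ℝ → ℝ,
      (∀ j l m, Integrable (h j l m)) ∧ ∀ l,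
      Tendsto (fun j => eLpNorm (specRow C (freqResponse (h j)) l t - specRow C F l t) 2)
        atTop (𝓝 0) ∧
      Tendsto (fun j => eLpNorm (conv (h j) x t l - v l) 2 P) atTop (𝓝 0) := by
  obtain ⟨h, hh, hlim, hconv⟩ := hv.2
  have hmeas : ∀ l, AEStronglyMeasurable (specRow C F l t) := fun l =>
    aestronglyMeasurable_specRow hx.posSemidef (fun i j => (hx.integrable i j).aemeasurable)
      (fun l m => (hF l m).aemeasurable) l t
  have hrow : ∀ l,
      Tendsto (fun j => eLpNorm (specRow C (freqResponse (h j)) l t - specRow C F l t) 2)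
        atTop (𝓝 0) := by
    intro l
    refine tendsto_eLpNorm_two_of_tendsto_lintegral ?_
    refine tendsto_of_tendsto_of_tendsto_of_le_of_le tendsto_const_nhds hlim
      (fun j => zero_le) fun j => ?_
    refine lintegral_mono fun f => ENNReal.ofReal_le_ofReal ?_
    rw [Pi.sub_apply, ← specRow_sub, norm_specRow,
      ← sum_norm_sq_halfRow hx.posSemidef (fun f => freqResponse (h j) f - F f)]
    exact Finset.single_le_sum
      (f := fun l => ‖halfRow C (fun f => freqResponse (h j) f - F f) l f‖ ^ 2)
      (fun _ _ => by positivity) (Finset.mem_univ l)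
  refine ⟨fun l => ?_, h, hh, fun l => ⟨hrow l, hconv l⟩⟩
  obtain ⟨j, hj⟩ := ((hrow l).eventually_lt_const (u := 1) zero_lt_one).exists
  have h1 := memLp_specRow_freqResponse hx.posSemidef hx.integrable (hh j) l t
  have h2 : MemLp (specRow C (freqResponse (h j)) l t - specRow C F l t) 2 :=
    ⟨h1.aestronglyMeasurable.sub (hmeas l), hj.trans ENNReal.one_lt_top⟩
  simpa using h1.sub h2

theorem tendsto_toLp_of_tendsto_eLpNorm {α F : Type*} [MeasurableSpace α] {μ : Measure α}
    [NormedAddCommGroup F] {u : ℕ → α → F} {v : α → F} (hu : ∀ j, MemLp (u j) 2 μ)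
    (hv : MemLp v 2 μ) (h : Tendsto (fun j => eLpNorm (u j - v) 2 μ) atTop (𝓝 0)) :
    Tendsto (fun j => (hu j).toLp (u j)) atTop (𝓝 (hv.toLp v)) :=
  (Lp.tendsto_Lp_iff_tendsto_eLpNorm'' u hu v hv).2 h

theorem inputSigma_le (hx : IsWSS P x C) : inputSigma x ≤ ‹MeasurableSpace Ω› :=
  iSup_le fun m => iSup_le fun _ => ((hx.measurable m).comp measurable_prodMk_left).comap_le

variable [IsProbabilityMeasure P]

theorem IsWSS.memLp_conv (hx : IsWSS P x C) {h : Fin L → Fin M → ℝ → ℝ}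
    (hh : ∀ l m, Integrable (h l m)) (t : ℝ) (l : Fin L) : MemLp (conv h x t l) 2 P := by
  rw [conv_eq_sum]
  exact memLp_finsetSum _ fun m _ => hx.memLp_scalarConv (hh l m) m t

theorem IsWSS.integral_conv_mul_conv (hx : IsWSS P x C) {h : Fin L → Fin M → ℝ → ℝ}
    (hh : ∀ l m, Integrable (h l m)) {h' : Fin L' → Fin M → ℝ → ℝ}
    (hh' : ∀ l m, Integrable (h' l m)) (t t' : ℝ) (l : Fin L) (l' : Fin L') :
    ((∫ ω, conv h x t l ω * conv h' x t' l' ω ∂P : ℝ) : ℂ) =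
      ∫ f, inner ℂ (specRow C (freqResponse h) l t f) (specRow C (freqResponse h') l' t' f) := by
  simp only [inner_specRow hx.posSemidef, conv_eq_sum, Finset.sum_mul_sum]
  rw [integral_finsetSum _ fun i _ => integrable_finsetSum _ fun j _ =>
    integrable_mul_of_memLp (hx.memLp_scalarConv (hh l i) i t)
      (hx.memLp_scalarConv (hh' l' j) j t')]
  have hI : ∀ i j, Integrable fun f => expi f (t' - t) *
      (freqResponse h' f l' j * C f j i * star (freqResponse h f l i)) := fun i j =>
    (integrable_mul_expi (integrable_freqResponse_mul hx.integrable hh' hh l' l j i)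
      (t' - t)).congr (Eventually.of_forall fun f => mul_comm _ _)
  simp only [mul_mul_conjTranspose_apply, Finset.mul_sum]
  rw [integral_finsetSum _ fun i _ => integrable_finsetSum _ fun j _ => hI i j]
  push_cast
  refine Finset.sum_congr rfl fun i _ => ?_
  rw [integral_finsetSum _ fun j _ => integrable_mul_of_memLp
      (hx.memLp_scalarConv (hh l i) i t) (hx.memLp_scalarConv (hh' l' j) j t'),
    integral_finsetSum _ fun j _ => hI i j]
  push_cast
  refine Finset.sum_congr rfl fun j _ => ?_
  rw [hx.integral_scalarConv_mul_scalarConv (hh l i) (hh' l' j)]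
  refine integral_congr_ae (Eventually.of_forall fun f => ?_)
  have hc : (starRingEnd ℂ) (C f i j) = C f j i := (hx.posSemidef f).isHermitian.apply j i
  simp only [map_mul, conj_expi, hc, sub_eq_add_neg, expi_add]
  simp only [freqResponse, Matrix.of_apply, RCLike.star_def]
  ring

/-- Filter outputs are correlated as their spectral representatives. -/
theorem IsFilterOutput.inner_eq (hx : IsWSS P x C) {F : ℝ → Matrix (Fin L) (Fin M) ℂ}
    (hF : ∀ l m, Measurable fun f => F f l m) {t : ℝ} {v : Fin L → Ω → ℝ}
    (hv : IsFilterOutput P x C F t v) {G : ℝ → Matrix (Fin L') (Fin M) ℂ}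
    (hG : ∀ l m, Measurable fun f => G f l m) {t' : ℝ} {u : Fin L' → Ω → ℝ}
    (hu : IsFilterOutput P x C G t' u) (l : Fin L) (l' : Fin L') :
    ((∫ ω, v l ω * u l' ω ∂P : ℝ) : ℂ) =
      ∫ f, inner ℂ (specRow C F l t f) (specRow C G l' t' f) := by
  obtain ⟨mF, h, hh, hlim⟩ := hv.exists_approx hx hF
  obtain ⟨mG, g, hg, glim⟩ := hu.exists_approx hx hG
  have a1 := tendsto_toLp_of_tendsto_eLpNorm (fun j => hx.memLp_conv (hh j) t l) (hv.1 l)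
    (hlim l).2
  have a2 := tendsto_toLp_of_tendsto_eLpNorm (fun j => hx.memLp_conv (hg j) t' l') (hu.1 l')
    (glim l').2
  have b1 := tendsto_toLp_of_tendsto_eLpNorm
    (fun j => memLp_specRow_freqResponse hx.posSemidef hx.integrable (hh j) l t) (mF l) (hlim l).1
  have b2 := tendsto_toLp_of_tendsto_eLpNorm
    (fun j => memLp_specRow_freqResponse hx.posSemidef hx.integrable (hg j) l' t') (mG l')
    (glim l').1
  have a := (Complex.continuous_ofReal.tendsto _).comp (a1.inner a2 (𝕜 := ℝ))
  have b := b1.inner b2 (𝕜 := ℂ)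
  rw [real_inner_toLp] at a
  rw [inner_toLp] at b
  refine tendsto_nhds_unique (a.congr fun j => ?_) b
  rw [Function.comp_apply, real_inner_toLp, inner_toLp]
  exact hx.integral_conv_mul_conv (hh j) (hg j) t t' l l'

/-- Filter outputs are functions of the input signals. -/
theorem IsFilterOutput.aestronglyMeasurable_inputSigma (hx : IsWSS P x C)
    {F : ℝ → Matrix (Fin L) (Fin M) ℂ} (hF : ∀ l m, Measurable fun f => F f l m) {t : ℝ}
    {v : Fin L → Ω → ℝ} (hv : IsFilterOutput P x C F t v) (l : Fin L) :
    AEStronglyMeasurable[inputSigma x] (v l) P := by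
  have hle := inputSigma_le hx
  have : Fact (inputSigma x ≤ ‹MeasurableSpace Ω›) := ⟨hle⟩
  let S : Submodule ℝ (Lp ℝ 2 P) := lpMeas ℝ ℝ (inputSigma x) 2 P
  suffices h : (hv.1 l).toLp (v l) ∈ S from
    (mem_lpMeas_iff_aestronglyMeasurable.1 h).congr (hv.1 l).coeFn_toLp
  -- Joint measurability of the process is known for the ambient sigma-algebra only, so the argument
  -- goes by duality: a `W` orthogonal to the closed subspace `S` is orthogonal to every `x m s`,
  -- hence to every convolution, hence to the limit `v l`.
  rw [← S.orthogonal_orthogonal, Submodule.mem_orthogonal]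
  intro W hW
  rw [Submodule.mem_orthogonal] at hW
  obtain ⟨mF, h, hh, hlim⟩ := hv.exists_approx hx hF
  have a1 := tendsto_toLp_of_tendsto_eLpNorm (fun j => hx.memLp_conv (hh j) t l) (hv.1 l)
    (hlim l).2
  refine tendsto_nhds_unique ((tendsto_const_nhds (x := W)).inner a1 (𝕜 := ℝ)) ?_
  refine tendsto_const_nhds.congr fun j => ?_
  have hWm := Lp.memLp W
  have hWx : ∀ m s, ∫ ω, W ω * x m s ω ∂P = 0 := by
    intro m s
    have h1 : (hx.memLp m s).toLp (x m s) ∈ S := by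
      refine mem_lpMeas_iff_aestronglyMeasurable.2 (AEStronglyMeasurable.congr ?_
        (hx.memLp m s).coeFn_toLp.symm)
      refine (Measurable.aestronglyMeasurable ?_)
      exact measurable_iff_comap_le.2 (le_iSup_of_le m (le_iSup_of_le s le_rfl))
    have h2 := hW _ h1
    rw [← Lp.toLp_coeFn W hWm, real_inner_toLp] at h2
    simpa only [mul_comm] using h2
  rw [← Lp.toLp_coeFn W hWm, real_inner_toLp]
  simp only [conv_eq_sum, Finset.mul_sum]
  rw [integral_finsetSum _ fun m _ =>
    integrable_mul_of_memLp hWm (hx.memLp_scalarConv (hh j l m) m t)]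
  refine (Finset.sum_eq_zero fun m _ => ?_).symm
  rw [hx.integral_mul_scalarConv hWm (hh j l m)]
  simp [hWx]

end Gram

/-! ### Fourier uniqueness and closed spans of modulated rows. -/

/-- An integrable function with vanishing Fourier integrals vanishes almost everywhere. -/
theorem ae_eq_zero_of_integral_expi_eq_zero {g : ℝ → ℂ} (hg : Integrable g)
    (h : ∀ t, ∫ f, g f * expi f t = 0) : ∀ᵐ f, g f = 0 := by
  refine ae_eq_zero_of_integral_contDiff_smul_eq_zero hg.locallyIntegrable fun φ hφ hφc => ?_
  have hF : 𝓕 g = 0 := by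
    funext w
    rw [fourier_eq_integral_expi, Pi.zero_apply, ← h (-w)]
    refine integral_congr_ae (Eventually.of_forall fun f => ?_)
    simp only [expi_eq]
    congr 4
    ring
  have h1 : ContDiff ℝ ((⊤ : ℕ∞) : WithTop ℕ∞) (fun f => (φ f : ℂ)) :=
    Complex.ofRealCLM.contDiff.comp hφ
  have h2 : HasCompactSupport (fun f => (φ f : ℂ)) :=
    hφc.comp_left (g := fun r : ℝ => (r : ℂ)) Complex.ofReal_zero
  let ψ : SchwartzMap ℝ ℂ := h2.toSchwartzMap h1
  -- The test function is the Fourier transform of `θ`, so `∫ φ g = ∫ θ 𝓕 g = 0` by moving the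
  -- transform onto `g`.
  let θ : SchwartzMap ℝ ℂ := 𝓕⁻ ψ
  have hθ : ∀ f, 𝓕 (fun t => θ t) f = φ f := by
    intro f
    have : 𝓕 θ = ψ := FourierTransform.fourier_fourierInv_eq ψ
    have h3 := congrArg (fun u : SchwartzMap ℝ ℂ => u f) this
    rw [SchwartzMap.fourier_coe] at h3
    exact h3
  have key := VectorFourier.integral_fourierIntegral_smul_eq_flip (L := innerₗ ℝ)
    (μ := (volume : Measure ℝ)) (ν := (volume : Measure ℝ)) (f := fun t => θ t) (g := g)
    Real.continuous_fourierChar continuous_inner θ.integrable hg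
  have e1 : ∀ u : ℝ → ℂ, VectorFourier.fourierIntegral Real.fourierChar volume (innerₗ ℝ) u = 𝓕 u :=
    fun u => rfl
  rw [flip_innerₗ, e1, e1, hF] at key
  simp only [hθ] at key
  simpa using key

section ClosureSpan

variable {M N K : ℕ} {C : ℝ → Matrix (Fin M) (Fin M) ℂ}

theorem halfRow_eq_sum {F : ℝ → Matrix (Fin N) (Fin M) ℂ} {G : ℝ → Matrix (Fin K) (Fin M) ℂ}
    {f : ℝ} {A : Matrix (Fin N) (Fin K) ℂ}
    (h : F f * CFC.sqrt (C f) = A * (G f * CFC.sqrt (C f))) (n : Fin N) :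
    halfRow C F n f = ∑ k, A n k • halfRow C G k f := by
  ext m
  rw [halfRow_apply, h, Matrix.mul_apply]
  simp [halfRow_apply]

/-- A weighted response that is pointwise a left multiple of another one lies in the closed span of
the modulations of the latter. -/
theorem toLp_specRow_mem_closure {F : ℝ → Matrix (Fin N) (Fin M) ℂ}
    {G : ℝ → Matrix (Fin K) (Fin M) ℂ}
    (h : ∀ f, ∃ A : Matrix (Fin N) (Fin K) ℂ, F f * CFC.sqrt (C f) = A * (G f * CFC.sqrt (C f)))
    (n : Fin N) (t : ℝ) (hF : MemLp (specRow C F n t) 2)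
    (hG : ∀ p : Fin K × ℝ, MemLp (specRow C G p.1 p.2) 2) :
    hF.toLp _ ∈ (Submodule.span ℂ (Set.range fun p => (hG p).toLp _)).topologicalClosure := by
  rw [← Submodule.orthogonal_orthogonal_eq_closure, Submodule.mem_orthogonal]
  intro g hg
  rw [Submodule.mem_orthogonal] at hg
  have hgm := Lp.memLp g
  have hinner : ∀ u : ℝ → EuclideanSpace ℂ (Fin M), ∀ hu : MemLp u 2,
      inner ℂ (hu.toLp u) g = ∫ f, inner ℂ (u f) (g f) := by
    intro u hu
    conv_lhs => rw [← Lp.toLp_coeFn g hgm]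
    exact inner_toLp hu hgm
  have hk : ∀ k, ∀ᵐ f, inner ℂ (halfRow C G k f) (g f) = 0 := by
    intro k
    refine ae_eq_zero_of_integral_expi_eq_zero ?_ fun t => ?_
    · refine (L2.integrable_inner (𝕜 := ℂ) ((hG (k, 0)).toLp _) g).congr ?_
      filter_upwards [(hG (k, 0)).coeFn_toLp] with f hf
      rw [hf, specRow, expi_zero, one_smul]
    · have h1 := hg _ (Submodule.subset_span ⟨(k, -t), rfl⟩)
      simp only at h1
      rw [hinner] at h1
      rw [← h1]
      refine integral_congr_ae (Eventually.of_forall fun f => ?_)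
      simp only [specRow, inner_smul_left, conj_expi, neg_neg]
      ring
  rw [← inner_conj_symm, hinner, map_eq_zero]
  refine integral_eq_zero_of_ae ?_
  filter_upwards [ae_all_iff.2 hk] with f hf
  -- Orthogonality is already pointwise in `f`, so `A` may be chosen separately at each frequency,
  -- with no measurable selection.
  obtain ⟨A, hA⟩ := h f
  rw [specRow, inner_smul_left, halfRow_eq_sum hA, sum_inner]
  simp [inner_smul_left, hf]

/-- If the vectors `U` of a complex inner product space have the same (real) Gram matrix as the
vectors `u` of a real one, then membership in closed spans transfers from `U` to `u`. -/
theorem mem_closure_span_of_gram {E F ι : Type*} [NormedAddCommGroup E] [InnerProductSpace ℂ E]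
    [NormedAddCommGroup F] [InnerProductSpace ℝ F] {u₀ : F} {u : ι → F} {U₀ : E} {U : ι → E}
    (h00 : inner ℂ U₀ U₀ = ((inner ℝ u₀ u₀ : ℝ) : ℂ))
    (h0 : ∀ i, inner ℂ U₀ (U i) = ((inner ℝ u₀ (u i) : ℝ) : ℂ))
    (h : ∀ i j, inner ℂ (U i) (U j) = ((inner ℝ (u i) (u j) : ℝ) : ℂ))
    (hU : U₀ ∈ (Submodule.span ℂ (Set.range U)).topologicalClosure) :
    u₀ ∈ (Submodule.span ℝ (Set.range u)).topologicalClosure := by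
  have h0' : ∀ i, inner ℂ (U i) U₀ = ((inner ℝ (u i) u₀ : ℝ) : ℂ) := fun i => by
    rw [← inner_conj_symm, h0, Complex.conj_ofReal, real_inner_comm]
  rw [← SetLike.mem_coe, Submodule.topologicalClosure_coe, Metric.mem_closure_iff] at hU ⊢
  intro ε hε
  obtain ⟨W, hW, hdist⟩ := hU ε hε
  obtain ⟨c, rfl⟩ := Finsupp.mem_span_range_iff_exists_finsupp.1 hW
  -- Dropping the imaginary parts of the coefficients cannot worsen the approximation: the error is
  -- `X - iY` with `⟪X, Y⟫` real, so its squared norm is `‖X‖² + ‖Y‖²`.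
  refine ⟨∑ i ∈ c.support, (c i).re • u i, Submodule.sum_mem _ fun i _ =>
    Submodule.smul_mem _ _ (Submodule.subset_span ⟨i, rfl⟩), lt_of_le_of_lt ?_ hdist⟩
  set X : E := U₀ - ∑ i ∈ c.support, ((c i).re : ℂ) • U i with hX
  set Y : E := ∑ i ∈ c.support, ((c i).im : ℂ) • U i with hY
  have e1 : U₀ - c.sum (fun i a => a • U i) = X - Complex.I • Y := by
    rw [hX, hY, Finsupp.sum, Finset.smul_sum, sub_sub, ← Finset.sum_add_distrib]
    congr 1
    refine Finset.sum_congr rfl fun i _ => ?_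
    rw [smul_smul, ← add_smul, mul_comm Complex.I, Complex.re_add_im]
  have e2 : inner ℂ X Y = ((inner ℝ (u₀ - ∑ i ∈ c.support, (c i).re • u i)
      (∑ i ∈ c.support, (c i).im • u i) : ℝ) : ℂ) := by
    simp only [hX, hY, inner_sub_left, sum_inner, inner_sum, inner_smul_left, inner_smul_right, h0,
      h, Complex.conj_ofReal, conj_trivial]
    push_cast
    rfl
  have e3 : inner ℂ X X = ((inner ℝ (u₀ - ∑ i ∈ c.support, (c i).re • u i)
      (u₀ - ∑ i ∈ c.support, (c i).re • u i) : ℝ) : ℂ) := by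
    simp only [hX, inner_sub_left, inner_sub_right, sum_inner, inner_sum, inner_smul_left,
      inner_smul_right, h0, h00, h0', h, Complex.conj_ofReal, conj_trivial]
    push_cast
    rfl
  have e4 : ‖X‖ = ‖u₀ - ∑ i ∈ c.support, (c i).re • u i‖ := by
    rw [real_inner_self_eq_norm_sq, inner_self_eq_norm_sq_to_K] at e3
    refine (sq_eq_sq₀ (norm_nonneg _) (norm_nonneg _)).1 ?_
    exact Complex.ofReal_injective (by simpa using e3)
  have e5 : ‖X - Complex.I • Y‖ ^ 2 = ‖X‖ ^ 2 + ‖Y‖ ^ 2 := by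
    rw [@norm_sub_sq ℂ, inner_smul_right, e2, norm_smul, Complex.norm_I, one_mul]
    simp
  rw [dist_eq_norm, dist_eq_norm, e1, ← e4]
  exact abs_le_of_sq_le_sq' (by rw [e5]; nlinarith [sq_nonneg ‖Y‖]) (norm_nonneg _) |>.2

end ClosureSpan

/-! ### Closed span, power and continuity of the filter outputs. -/

section Outputs

variable {Ω : Type*} [MeasurableSpace Ω] {P : Measure Ω} {M N K : ℕ}
  {x : Fin M → ℝ → Ω → ℝ} {C : ℝ → Matrix (Fin M) (Fin M) ℂ}

theorem IsFilterOutput.integrable_norm_sq_halfRow (hx : IsWSS P x C)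
    {F : ℝ → Matrix (Fin N) (Fin M) ℂ} (hF : ∀ n m, Measurable fun f => F f n m)
    {t : ℝ} {v : Fin N → Ω → ℝ} (hv : IsFilterOutput P x C F t v) (n : Fin N) :
    Integrable fun f => ‖halfRow C F n f‖ ^ 2 := by
  have h := (hv.exists_approx hx hF).1 n
  have h1 := (memLp_two_iff_integrable_sq_norm h.aestronglyMeasurable).1 h
  simpa only [norm_specRow] using h1

variable [IsProbabilityMeasure P]

/-- Under sufficiency the output of `F` lies in the closed span of the outputs of `G` at all
times. -/
theorem IsFilterOutput.mem_closure_span (hx : IsWSS P x C)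
    {F : ℝ → Matrix (Fin N) (Fin M) ℂ} (hF : ∀ n m, Measurable fun f => F f n m)
    {G : ℝ → Matrix (Fin K) (Fin M) ℂ} (hG : ∀ k m, Measurable fun f => G f k m)
    (h : ∀ f, ∃ A : Matrix (Fin N) (Fin K) ℂ, F f * CFC.sqrt (C f) = A * (G f * CFC.sqrt (C f)))
    {t : ℝ} {v : Fin N → Ω → ℝ} (hv : IsFilterOutput P x C F t v) {y : Fin K → ℝ → Ω → ℝ}
    (hy : ∀ t, IsFilterOutput P x C G t fun k => y k t) (n : Fin N) :
    (hv.1 n).toLp (v n) ∈ (Submodule.span ℝ (Set.range fun p : Fin K × ℝ =>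
      ((hy p.2).1 p.1).toLp (y p.1 p.2))).topologicalClosure := by
  have hFm := (hv.exists_approx hx hF).1 n
  have hGm : ∀ p : Fin K × ℝ, MemLp (specRow C G p.1 p.2) 2 := fun p =>
    ((hy p.2).exists_approx hx hG).1 p.1
  refine mem_closure_span_of_gram ?_ ?_ ?_ (toLp_specRow_mem_closure h n t hFm hGm)
  · rw [real_inner_toLp, inner_toLp, hv.inner_eq hx hF hF hv]
  · intro p
    rw [real_inner_toLp, inner_toLp, hv.inner_eq hx hF hG (hy p.2)]
  · intro p q
    rw [real_inner_toLp, inner_toLp, (hy p.2).inner_eq hx hG hG (hy q.2)]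

theorem IsFilterOutput.integral_sq_eq (hx : IsWSS P x C)
    {F : ℝ → Matrix (Fin N) (Fin M) ℂ} (hF : ∀ n m, Measurable fun f => F f n m)
    {t : ℝ} {v : Fin N → Ω → ℝ} (hv : IsFilterOutput P x C F t v) (n : Fin N) :
    ∫ ω, v n ω ^ 2 ∂P = ∫ f, ‖halfRow C F n f‖ ^ 2 := by
  have h := hv.inner_eq hx hF hF hv n n
  simp only [inner_self_eq_norm_sq_to_K, norm_specRow] at h
  simp only [pow_two (v n _)]
  rw [← Complex.ofReal_inj, h, ← integral_complex_ofReal]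
  refine integral_congr_ae (Eventually.of_forall fun f => ?_)
  simp

/-- Filter outputs are mean-square continuous. -/
theorem continuous_toLp_output (hx : IsWSS P x C)
    {G : ℝ → Matrix (Fin K) (Fin M) ℂ} (hG : ∀ k m, Measurable fun f => G f k m)
    {y : Fin K → ℝ → Ω → ℝ} (hy : ∀ t, IsFilterOutput P x C G t fun k => y k t) (k : Fin K) :
    Continuous fun t => ((hy t).1 k).toLp (y k t) := by
  have hcorr : ∀ s t, inner ℝ (((hy s).1 k).toLp (y k s)) (((hy t).1 k).toLp (y k t)) =
      (∫ f, (‖halfRow C G k f‖ ^ 2 : ℝ) * expi f (t - s)).re := by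
    intro s t
    rw [real_inner_toLp, ← Complex.ofReal_re (∫ a, _ ∂P), (hy s).inner_eq hx hG hG (hy t)]
    congr 1
    refine integral_congr_ae (Eventually.of_forall fun f => ?_)
    simp only [specRow, inner_smul_left, inner_smul_right, inner_self_eq_norm_sq_to_K, conj_expi,
      sub_eq_add_neg, expi_add]
    push_cast
    simp only [Complex.coe_algebraMap]
    ring
  have hint := ((hy 0).integrable_norm_sq_halfRow hx hG k).ofReal (𝕜 := ℂ)
  have hcont : Continuous fun τ : ℝ => (∫ f, (‖halfRow C G k f‖ ^ 2 : ℝ) * expi f τ).re := by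
    refine Complex.continuous_re.comp (continuous_of_dominated
      (fun τ => (integrable_mul_expi hint τ).aestronglyMeasurable)
      (bound := fun f => ‖halfRow C G k f‖ ^ 2) (fun τ => Eventually.of_forall fun f => ?_)
      ((hy 0).integrable_norm_sq_halfRow hx hG k) (Eventually.of_forall fun f => ?_))
    · rw [norm_mul, norm_expi, mul_one, Complex.norm_real, Real.norm_of_nonneg (by positivity)]
    · exact continuous_const.mul
        (continuous_expi.comp (by fun_prop : Continuous fun τ : ℝ => (f, τ)))
  rw [continuous_iff_continuousAt]
  intro s
  rw [ContinuousAt, tendsto_iff_norm_sub_tendsto_zero]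
  have h1 : ∀ t, ‖((hy t).1 k).toLp (y k t) - ((hy s).1 k).toLp (y k s)‖ =
      √(2 * (∫ f, (‖halfRow C G k f‖ ^ 2 : ℝ) * expi f 0).re -
        2 * (∫ f, (‖halfRow C G k f‖ ^ 2 : ℝ) * expi f (s - t)).re) := by
    intro t
    rw [← Real.sqrt_sq (norm_nonneg _), norm_sub_sq_real, ← real_inner_self_eq_norm_sq,
      ← real_inner_self_eq_norm_sq, hcorr, hcorr, hcorr, sub_self, sub_self]
    congr 1
    ring
  simp only [h1]
  have h2 : Continuous fun t : ℝ => √(2 * (∫ f, (‖halfRow C G k f‖ ^ 2 : ℝ) * expi f 0).re -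
        2 * (∫ f, (‖halfRow C G k f‖ ^ 2 : ℝ) * expi f (s - t)).re) :=
    (continuous_const.sub (continuous_const.mul
      (hcont.comp (continuous_const.sub continuous_id)))).sqrt
  have h3 := h2.tendsto s
  simpa using h3

end Outputs

/-! ### Regularized matrix inverses. -/

section Resolvent

variable {N K : ℕ} {W : Matrix (Fin K) (Fin K) ℂ} {δ : ℝ}

theorem trace_re_nonneg {n : ℕ} {Q : Matrix (Fin n) (Fin n) ℂ} (hQ : Q.PosSemidef) :
    0 ≤ (trace Q).re :=
  (Complex.le_def.1 hQ.trace_nonneg).1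

theorem posDef_add_smul_one (hW : W.PosSemidef) (hδ : 0 < δ) :
    (W + (δ : ℂ) • (1 : Matrix (Fin K) (Fin K) ℂ)).PosDef :=
  Matrix.PosDef.posSemidef_add hW (Matrix.PosDef.one.smul (by exact_mod_cast hδ))

/-- The regularized projection error `W - W (W + δ)⁻¹ W` lies between `0`, `W` and `δ`. -/
theorem resolvent_bounds (hW : W.PosSemidef) (hδ : 0 < δ) (A : Matrix (Fin N) (Fin K) ℂ) :
    let R := (W + (δ : ℂ) • (1 : Matrix (Fin K) (Fin K) ℂ))⁻¹
    0 ≤ (trace (A * W * R * (A * W)ᴴ)).re ∧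
    (trace (A * W * R * (A * W)ᴴ)).re ≤ (trace (A * W * Aᴴ)).re ∧
    (trace (A * W * Aᴴ)).re - (trace (A * W * R * (A * W)ᴴ)).re ≤ δ * (trace (A * Aᴴ)).re := by
  intro R
  have hV := posDef_add_smul_one hW hδ
  have hR : R.PosDef := hV.inv
  have hdet : IsUnit (W + (δ : ℂ) • (1 : Matrix (Fin K) (Fin K) ℂ)).det :=
    (Matrix.isUnit_iff_isUnit_det _).1 hV.isUnit
  have h1 : R * W = 1 - (δ : ℂ) • R := by
    have := Matrix.nonsing_inv_mul _ hdet
    rw [Matrix.mul_add, Matrix.mul_smul, Matrix.mul_one] at this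
    exact eq_sub_of_add_eq this
  have h2 : W * R = 1 - (δ : ℂ) • R := by
    have := Matrix.mul_nonsing_inv _ hdet
    rw [Matrix.add_mul, Matrix.smul_mul, Matrix.one_mul] at this
    exact eq_sub_of_add_eq this
  have hWh : Wᴴ = W := hW.isHermitian
  have hRh : Rᴴ = R := hR.isHermitian
  have e0 : A * W * R * (A * W)ᴴ = A * (W * R * W) * Aᴴ := by
    rw [Matrix.conjTranspose_mul, hWh]
    simp only [Matrix.mul_assoc]
  have e1 : W - W * R * W = (δ : ℂ) • (1 - (δ : ℂ) • R) := by
    rw [h2, Matrix.sub_mul, Matrix.one_mul, Matrix.smul_mul, h1, sub_sub_cancel]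
  -- The error is `δ W R`; inserting `1 = (W + δ) R` shows it as a sum of congruences of positive
  -- semidefinite matrices. The form `δ (1 - δ R)` in `e1` gives the upper bound `δ`.
  have e2 : W - W * R * W = (δ : ℂ) • (R * (W * W) * Rᴴ) + (δ : ℂ) • ((δ : ℂ) • (R * W * Rᴴ)) := by
    have h3 : R * (W * W) * Rᴴ = (1 - (δ : ℂ) • R) * (1 - (δ : ℂ) • R) := by
      rw [hRh, ← Matrix.mul_assoc R, h1, Matrix.mul_assoc, h2]
    have h4 : R * W * Rᴴ = (1 - (δ : ℂ) • R) * R := by rw [hRh, h1]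
    rw [e1, h3, h4, ← smul_add, ← Matrix.mul_smul, ← Matrix.mul_add, sub_add_cancel,
      Matrix.mul_one]
  have hWW : (W * W).PosSemidef := by
    have := Matrix.posSemidef_self_mul_conjTranspose W
    rwa [hWh] at this
  have hδ' : (0 : ℂ) ≤ (δ : ℂ) := by exact_mod_cast hδ.le
  refine ⟨?_, ?_, ?_⟩
  · exact trace_re_nonneg (hR.posSemidef.mul_mul_conjTranspose_same (A * W))
  · rw [e0, ← sub_nonneg, ← Complex.sub_re, ← Matrix.trace_sub, ← Matrix.sub_mul, ← Matrix.mul_sub,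
      e2]
    exact trace_re_nonneg ((((hWW.mul_mul_conjTranspose_same R).smul hδ').add
      (((hW.mul_mul_conjTranspose_same R).smul hδ').smul hδ')).mul_mul_conjTranspose_same A)
  · rw [e0, ← Complex.sub_re, ← Matrix.trace_sub, ← Matrix.sub_mul, ← Matrix.mul_sub, e1]
    have h5 : A * ((δ : ℂ) • (1 - (δ : ℂ) • R)) * Aᴴ =
        (δ : ℂ) • (A * Aᴴ) - (δ : ℂ) • ((δ : ℂ) • (A * R * Aᴴ)) := by
      rw [smul_sub, Matrix.mul_sub, Matrix.sub_mul]
      simp only [Matrix.mul_smul, Matrix.smul_mul, Matrix.mul_one]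
    have h6 := trace_re_nonneg (hR.posSemidef.mul_mul_conjTranspose_same A)
    rw [h5, Matrix.trace_sub, Matrix.trace_smul, Matrix.trace_smul, Matrix.trace_smul,
      Complex.sub_re, smul_eq_mul, smul_eq_mul, smul_eq_mul, Complex.re_ofReal_mul,
      Complex.re_ofReal_mul, Complex.re_ofReal_mul]
    have : 0 ≤ δ * (δ * (trace (A * R * Aᴴ)).re) := by positivity
    linarith

theorem measurable_inv_apply (i j : Fin K) :
    Measurable fun a : Fin K → Fin K → ℂ => ((Matrix.of a)⁻¹ : Matrix (Fin K) (Fin K) ℂ) i j := by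
  simp only [Matrix.inv_def, Ring.inverse_eq_inv', Matrix.smul_apply, smul_eq_mul]
  have h1 : Continuous fun a : Fin K → Fin K → ℂ => (Matrix.of a).det :=
    Continuous.matrix_det (A := fun a : Fin K → Fin K → ℂ => Matrix.of a) continuous_id
  have h2 : Continuous fun a : Fin K → Fin K → ℂ => (Matrix.of a).adjugate i j :=
    (Continuous.matrix_adjugate (A := fun a : Fin K → Fin K → ℂ => Matrix.of a)
      continuous_id).matrix_elem i j
  exact h1.measurable.inv.mul h2.measurable

theorem aemeasurable_trace_re {C : ℝ → Matrix (Fin K) (Fin K) ℂ}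
    (hC : ∀ i j, AEMeasurable (fun f => C f i j)) {F : ℝ → Matrix (Fin N) (Fin K) ℂ}
    (hF : ∀ n m, AEMeasurable fun f => F f n m) :
    AEMeasurable fun f => (trace (F f * C f * (F f)ᴴ)).re := by
  refine Complex.measurable_re.comp_aemeasurable ?_
  simp only [Matrix.trace, Matrix.diag_apply, mul_mul_conjTranspose_apply]
  exact Finset.aemeasurable_fun_sum _ fun n _ => Finset.aemeasurable_fun_sum _ fun j _ =>
    Finset.aemeasurable_fun_sum _ fun i _ => ((hF n i).mul (hC i j)).mul
      (continuous_star.measurable.comp_aemeasurable (hF n j))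

end Resolvent

/-! ### Convergence of the closed-form expression. -/

section ClosedForm

variable {M N K : ℕ} {C : ℝ → Matrix (Fin M) (Fin M) ℂ}

/-- A shift by a nonzero multiple of `fs` moves a baseband frequency to modulus at least `fs / 2 >
B`, where `C` vanishes. -/
theorem aliased_eq {B : ℝ} (hB : ∀ f : ℝ, B < |f| → C f = 0)
    (F : ℝ → Matrix (Fin N) (Fin M) ℂ) (G : ℝ → Matrix (Fin K) (Fin M) ℂ) {Ts : ℝ} (hTs : 0 < Ts)
    (hBT : B < (1 / Ts) / 2) {f : ℝ} (hf : |f| ≤ (1 / Ts) / 2) :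
    aliased C F G Ts f = F f * C f * (G f)ᴴ := by
  rw [aliased, tsum_eq_single 0]
  · simp
  · intro k hk
    rw [hB, Matrix.mul_zero, Matrix.zero_mul]
    have h1 : (1 : ℝ) ≤ |(k : ℝ)| := by exact_mod_cast Int.one_le_abs hk
    have h2 : |(k : ℝ) * (1 / Ts)| = |(k : ℝ)| * (1 / Ts) := by
      rw [abs_mul, abs_of_pos (by positivity : 0 < 1 / Ts)]
    have h3 : (1 / Ts) ≤ |(k : ℝ)| * (1 / Ts) := le_mul_of_one_le_left (by positivity) h1
    have h4 := abs_sub_abs_le_abs_sub ((k : ℝ) * (1 / Ts)) f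
    rw [abs_sub_comm, h2] at h4
    linarith

/-- Factoring out `Ts` turns the noise power `Δ² / 4` into the density `Δ² / (4 Ts)`. In the
singular case both inverses are zero by convention. -/
theorem inv_outputPSD {B : ℝ} (hB : ∀ f : ℝ, B < |f| → C f = 0)
    (H : ℝ → Matrix (Fin K) (Fin M) ℂ) {Ts : ℝ} (hTs : 0 < Ts)
    (hBT : B < (1 / Ts) / 2) {f : ℝ} (hf : |f| ≤ (1 / Ts) / 2) (Δ : ℝ) :
    (outputPSD C H Δ Ts f)⁻¹ = ((Ts⁻¹ : ℝ) : ℂ) •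
      (H f * C f * (H f)ᴴ + ((Δ ^ 2 / (4 * Ts) : ℝ) : ℂ) • (1 : Matrix (Fin K) (Fin K) ℂ))⁻¹ := by
  have hT : (Ts : ℂ) ≠ 0 := by exact_mod_cast hTs.ne'
  have h1 : outputPSD C H Δ Ts f = (Ts : ℂ) •
      (H f * C f * (H f)ᴴ + ((Δ ^ 2 / (4 * Ts) : ℝ) : ℂ) • (1 : Matrix (Fin K) (Fin K) ℂ)) := by
    rw [outputPSD, aliased_eq hB H H hTs hBT hf, smul_add, smul_smul]
    congr 2
    push_cast
    field_simp
  rw [h1]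
  by_cases hdet : IsUnit (H f * C f * (H f)ᴴ +
      ((Δ ^ 2 / (4 * Ts) : ℝ) : ℂ) • (1 : Matrix (Fin K) (Fin K) ℂ)).det
  · refine Matrix.inv_eq_right_inv ?_
    rw [Matrix.smul_mul, Matrix.mul_smul, smul_smul, Matrix.mul_nonsing_inv _ hdet]
    push_cast
    rw [mul_inv_cancel₀ hT, one_smul]
  · rw [Matrix.nonsing_inv_apply_not_isUnit _ hdet, smul_zero, Matrix.nonsing_inv_apply_not_isUnit]
    rw [Matrix.det_smul, IsUnit.mul_iff]
    exact fun h => hdet h.2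

variable {Ω : Type*} [MeasurableSpace Ω] {P : Measure Ω} {x : Fin M → ℝ → Ω → ℝ}

/-- The spectral density of the reduction of the error achieved by a Wiener filter for the filtered
signal with additive white noise of power `δ`. -/
def wienerGain (C : ℝ → Matrix (Fin M) (Fin M) ℂ) (Γ : ℝ → Matrix (Fin N) (Fin M) ℂ)
    (H : ℝ → Matrix (Fin K) (Fin M) ℂ) (δ f : ℝ) : ℝ :=
  (trace ((Γ f * C f * (H f)ᴴ) * (H f * C f * (H f)ᴴ + (δ : ℂ) • (1 : Matrix (Fin K) (Fin K) ℂ))⁻¹ *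
    (Γ f * C f * (H f)ᴴ)ᴴ)).re

theorem mseExpression_eq {B : ℝ} (hB : ∀ f : ℝ, B < |f| → C f = 0)
    (Γ : ℝ → Matrix (Fin N) (Fin M) ℂ) (H : ℝ → Matrix (Fin K) (Fin M) ℂ) {Ts : ℝ} (hTs : 0 < Ts)
    (hBT : B < (1 / Ts) / 2) (Δ : ℝ) (st : Fin N → Ω → ℝ) :
    mseExpression P C Γ H st Δ Ts =
      (∫ ω, ∑ i, st i ω ^ 2 ∂P) - ∫ f, wienerGain C Γ H (Δ ^ 2 / (4 * Ts)) f := by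
  have hpos : 0 < 1 / Ts := by positivity
  have h1 : (-(1 / Ts) / 2) ≤ (1 / Ts) / 2 := by linarith
  rw [mseExpression, ← intervalIntegral.integral_const_mul, intervalIntegral.integral_of_le h1]
  congr 1
  rw [← setIntegral_eq_integral_of_forall_compl_eq_zero
    (s := Set.Ioc (-(1 / Ts) / 2) ((1 / Ts) / 2)) (f := wienerGain C Γ H (Δ ^ 2 / (4 * Ts)))]
  · refine setIntegral_congr_fun measurableSet_Ioc fun f hf => ?_
    have hf' : |f| ≤ (1 / Ts) / 2 := abs_le.2 ⟨by linarith [hf.1], hf.2⟩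
    rw [aliased_eq hB Γ H hTs hBT hf', inv_outputPSD hB H hTs hBT hf', wienerGain,
      Matrix.mul_smul, Matrix.smul_mul, Matrix.trace_smul, smul_eq_mul, Complex.re_ofReal_mul,
      mul_inv_cancel_left₀ hTs.ne']
  · intro f hf
    have hfB : B < |f| := by
      by_contra hcon
      have := abs_lt.1 ((not_lt.1 hcon).trans_lt hBT)
      exact hf ⟨by linarith [this.1], this.2.le⟩
    simp [wienerGain, hB f hfB]

theorem aemeasurable_mul_mul_conjTranspose (hC : ∀ i j, AEMeasurable (fun f => C f i j))
    {F : ℝ → Matrix (Fin N) (Fin M) ℂ} (hF : ∀ n m, Measurable fun f => F f n m)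
    {G : ℝ → Matrix (Fin K) (Fin M) ℂ} (hG : ∀ k m, Measurable fun f => G f k m)
    (n : Fin N) (k : Fin K) : AEMeasurable fun f => (F f * C f * (G f)ᴴ) n k := by
  simp only [mul_mul_conjTranspose_apply]
  exact Finset.aemeasurable_fun_sum _ fun j _ => Finset.aemeasurable_fun_sum _ fun i _ =>
    ((hF n i).aemeasurable.mul (hC i j)).mul 
      (continuous_star.measurable.comp (hG k j)).aemeasurable

theorem aemeasurable_wienerGain (hC : ∀ i j, AEMeasurable (fun f => C f i j))
    {Γ : ℝ → Matrix (Fin N) (Fin M) ℂ} (hΓ : ∀ n m, Measurable fun f => Γ f n m)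
    {H : ℝ → Matrix (Fin K) (Fin M) ℂ} (hH : ∀ k m, Measurable fun f => H f k m) (δ : ℝ) :
    AEMeasurable (wienerGain C Γ H δ) := by
  have h1 := aemeasurable_mul_mul_conjTranspose hC hΓ hH
  have h2 : ∀ i j, AEMeasurable fun f =>
      ((H f * C f * (H f)ᴴ + (δ : ℂ) • (1 : Matrix (Fin K) (Fin K) ℂ))⁻¹) i j := by
    intro i j
    refine (measurable_inv_apply i j).comp_aemeasurable (f := fun f i j =>
      (H f * C f * (H f)ᴴ + (δ : ℂ) • (1 : Matrix (Fin K) (Fin K) ℂ)) i j) ?_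
    refine aemeasurable_pi_lambda _ fun i => aemeasurable_pi_lambda _ fun j => ?_
    exact (aemeasurable_mul_mul_conjTranspose hC hH hH i j).add_const _
  exact aemeasurable_trace_re h2 h1

theorem trace_half_eq (hC : ∀ f, (C f).PosSemidef) {Γ : ℝ → Matrix (Fin N) (Fin M) ℂ}
    {H : ℝ → Matrix (Fin K) (Fin M) ℂ} {f : ℝ} {A : Matrix (Fin N) (Fin K) ℂ}
    (hA : Γ f * CFC.sqrt (C f) = A * (H f * CFC.sqrt (C f))) :
    Γ f * C f * (H f)ᴴ = A * (H f * C f * (H f)ᴴ) ∧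
      Γ f * C f * (Γ f)ᴴ = A * (H f * C f * (H f)ᴴ) * Aᴴ := by
  simp only [← half_mul_half_conjTranspose (hC f), hA, Matrix.conjTranspose_mul A]
  simp only [Matrix.mul_assoc, and_self]

/-- The closed-form expression tends to zero if the noise-to-signal power does, or if there is no
signal at all. -/
theorem tendsto_mseExpression [IsProbabilityMeasure P] (hx : IsWSS P x C) {B : ℝ} (hB : ∀ f : ℝ, B < |f| → C f = 0)
    {Γ : ℝ → Matrix (Fin N) (Fin M) ℂ} (hΓ : ∀ n m, Measurable fun f => Γ f n m)
    {H : ℝ → Matrix (Fin K) (Fin M) ℂ} (hH : ∀ k m, Measurable fun f => H f k m)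
    (h : ∀ f, ∃ A : Matrix (Fin N) (Fin K) ℂ, Γ f * CFC.sqrt (C f) = A * (H f * CFC.sqrt (C f)))
    {t : ℝ} {st : Fin N → Ω → ℝ} (hst : IsFilterOutput P x C Γ t st) {Δ : ℝ → ℝ}
    (hΔ : ∀ Ts > 0, 0 < Δ Ts)
    (hlim : Tendsto (fun Ts => Δ Ts ^ 2 / (4 * Ts)) (𝓝[>] 0) (𝓝 0) ∨
      ∀ k, ∀ᵐ f, halfRow C H k f = 0) :
    Tendsto (fun Ts => mseExpression P C Γ H st (Δ Ts) Ts) (𝓝[>] 0) (𝓝 0) := by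
  let e : ℝ → ℝ := fun f => (trace (Γ f * C f * (Γ f)ᴴ)).re
  have he : e = fun f => ∑ n, ‖halfRow C Γ n f‖ ^ 2 :=
    funext fun f => (sum_norm_sq_halfRow hx.posSemidef Γ f).symm
  have heint : Integrable e := by
    rw [he]
    exact integrable_finsetSum _ fun n _ => hst.integrable_norm_sq_halfRow hx hΓ n
  have hest : ∫ ω, ∑ i, st i ω ^ 2 ∂P = ∫ f, e f := by
    rw [he, integral_finsetSum _ fun n _ => (hst.1 n).integrable_sq,
      integral_finsetSum _ fun n _ => hst.integrable_norm_sq_halfRow hx hΓ n]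
    exact Finset.sum_congr rfl fun n _ => hst.integral_sq_eq hx hΓ n
  -- The constant `c` depends on `f` without control and serves for pointwise convergence only;
  -- domination is by `e`.
  have hbd : ∀ f, ∃ c : ℝ, ∀ δ > 0, 0 ≤ wienerGain C Γ H δ f ∧ wienerGain C Γ H δ f ≤ e f ∧
      e f - wienerGain C Γ H δ f ≤ δ * c := by
    intro f
    obtain ⟨A, hA⟩ := h f
    refine ⟨(trace (A * Aᴴ)).re, fun δ hδ => ?_⟩
    have hW := (hx.posSemidef f).mul_mul_conjTranspose_same (H f)
    have := resolvent_bounds hW hδ A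
    simpa only [wienerGain, e, (trace_half_eq hx.posSemidef hA).1,
      (trace_half_eq hx.posSemidef hA).2] using this
  have hmeas : ∀ δ, AEStronglyMeasurable (wienerGain C Γ H δ) := fun δ =>
    (aemeasurable_wienerGain (fun i j => (hx.integrable i j).aemeasurable) hΓ hH
      δ).aestronglyMeasurable
  have hδ : ∀ᶠ Ts : ℝ in 𝓝[>] 0, 0 < Δ Ts ^ 2 / (4 * Ts) := by
    filter_upwards [self_mem_nhdsWithin] with Ts hTs
    have := hΔ Ts hTs
    have hT : 0 < Ts := hTs
    positivity
  have hev : ∀ᶠ Ts : ℝ in 𝓝[>] 0, ∫ f, (e f - wienerGain C Γ H (Δ Ts ^ 2 / (4 * Ts)) f) =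
      mseExpression P C Γ H st (Δ Ts) Ts := by
    have hbig : Tendsto (fun Ts : ℝ => (1 / Ts) / 2) (𝓝[>] 0) atTop := by
      simp only [one_div]
      exact tendsto_inv_nhdsGT_zero.atTop_div_const two_pos
    filter_upwards [self_mem_nhdsWithin, hbig.eventually_gt_atTop B, hδ] with Ts hTs hBT hd
    rw [mseExpression_eq hB Γ H hTs hBT, hest, integral_sub heint]
    refine heint.mono' (hmeas _) (Eventually.of_forall fun f => ?_)
    obtain ⟨c, hc⟩ := hbd f
    rw [Real.norm_of_nonneg (hc _ hd).1]
    exact (hc _ hd).2.1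
  refine Tendsto.congr' hev ?_
  suffices hT : Tendsto (fun Ts => ∫ f, (e f - wienerGain C Γ H (Δ Ts ^ 2 / (4 * Ts)) f)) (𝓝[>] 0)
      (𝓝 (∫ _ : ℝ, (0 : ℝ))) by
    rwa [integral_zero] at hT
  refine tendsto_integral_filter_of_dominated_convergence e
    (Eventually.of_forall fun Ts => heint.aestronglyMeasurable.sub (hmeas _)) ?_ heint ?_
  · filter_upwards [hδ] with Ts hd
    refine Eventually.of_forall fun f => ?_
    obtain ⟨c, hc⟩ := hbd f
    have := hc _ hd
    rw [Real.norm_of_nonneg (by linarith)]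
    linarith
  · rcases hlim with hlim | hzero
    · refine Eventually.of_forall fun f => ?_
      obtain ⟨c, hc⟩ := hbd f
      have h1 := hlim.mul_const c
      rw [zero_mul] at h1
      refine squeeze_zero' ?_ ?_ h1
      · filter_upwards [hδ] with Ts hd
        linarith [(hc _ hd).2.1]
      · filter_upwards [hδ] with Ts hd using (hc _ hd).2.2
    · filter_upwards [ae_all_iff.2 hzero] with f hf
      obtain ⟨A, hA⟩ := h f
      -- Here the noise need not be small: where the rows of `H` vanish, so do those of `Γ`, and
      -- there is nothing to estimate.
      have hef : e f = 0 := by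
        rw [he]
        refine Finset.sum_eq_zero fun n _ => ?_
        rw [halfRow_eq_sum hA]
        simp [hf]
      obtain ⟨c, hc⟩ := hbd f
      refine tendsto_const_nhds.congr' ?_
      filter_upwards [hδ] with Ts hd
      linarith [(hc _ hd).1, (hc _ hd).2.1]

end ClosedForm

/-! ### The triangular law and the rounding error. -/

/-- The triangular law of the dither. -/
def ditherLaw (Δ : ℝ) : Measure ℝ :=
  volume.withDensity fun v : ℝ => ENNReal.ofReal (if |v| ≤ Δ then 1 / Δ * (1 - |v| / Δ) else 0)

section TriangularLaw

variable {Δ : ℝ}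

theorem measurable_triangular :
    Measurable fun v : ℝ => if |v| ≤ Δ then 1 / Δ * (1 - |v| / Δ) else 0 :=
  Measurable.ite (measurableSet_le (by fun_prop) (by fun_prop)) (by fun_prop) (by fun_prop)

theorem ae_abs_le_ditherLaw : ∀ᵐ v ∂ditherLaw Δ, |v| ≤ Δ := by
  rw [ditherLaw, ae_withDensity_iff measurable_triangular.ennreal_ofReal]
  refine Eventually.of_forall fun v hv => ?_
  by_contra hcon
  simp [hcon] at hv

/-- Continuity of `φ` is not asked for, since the discontinuous rounding error has to be admitted.
-/
theorem integral_ditherLaw (hΔ : 0 < Δ) {φ : ℝ → ℝ} (hφ : ∀ a b, IntervalIntegrable φ volume a b) :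
    ∫ v, φ v ∂ditherLaw Δ = (∫ v in (-Δ)..0, 1 / Δ * (1 + v / Δ) * φ v) +
      ∫ v in (0)..Δ, 1 / Δ * (1 - v / Δ) * φ v := by
  have hcont : Continuous fun v : ℝ => 1 / Δ * (1 - |v| / Δ) := by fun_prop
  have hnn : ∀ v : ℝ, |v| ≤ Δ → 0 ≤ 1 / Δ * (1 - |v| / Δ) := fun v hv => by
    have : |v| / Δ ≤ 1 := (div_le_one hΔ).2 hv
    exact mul_nonneg (by positivity) (by linarith)
  rw [ditherLaw, integral_withDensity_eq_integral_toReal_smul measurable_triangular.ennreal_ofReal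
    (Eventually.of_forall fun v => ENNReal.ofReal_lt_top)]
  have h1 : ∀ v : ℝ, (ENNReal.ofReal (if |v| ≤ Δ then 1 / Δ * (1 - |v| / Δ) else 0)).toReal • φ v =
      (Set.Icc (-Δ) Δ).indicator (fun v => 1 / Δ * (1 - |v| / Δ) * φ v) v := by
    intro v
    by_cases hv : |v| ≤ Δ
    · rw [Set.indicator_of_mem (Set.mem_Icc.2 (abs_le.1 hv)), if_pos hv,
        ENNReal.toReal_ofReal (hnn v hv), smul_eq_mul]
    · rw [Set.indicator_of_notMem fun h : v ∈ Set.Icc (-Δ) Δ => hv (abs_le.2 h), if_neg hv]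
      simp
  simp only [h1]
  have hint : ∀ a b, IntervalIntegrable (fun v => 1 / Δ * (1 - |v| / Δ) * φ v) volume a b :=
    fun a b => (hφ a b).continuousOn_mul hcont.continuousOn
  rw [integral_indicator measurableSet_Icc, integral_Icc_eq_integral_Ioc,
    ← intervalIntegral.integral_of_le (by linarith),
    ← intervalIntegral.integral_add_adjacent_intervals (hint (-Δ) 0) (hint 0 Δ)]
  congr 1
  · refine intervalIntegral.integral_congr fun v hv => ?_
    rw [Set.uIcc_of_le (by linarith)] at hv
    simp only [abs_of_nonpos hv.2]
    ring
  · refine intervalIntegral.integral_congr fun v hv => ?_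
    rw [Set.uIcc_of_le hΔ.le] at hv
    simp only [abs_of_nonneg hv.1]

theorem integral_id_ditherLaw (hΔ : 0 < Δ) : ∫ v, v ∂ditherLaw Δ = 0 := by
  rw [integral_ditherLaw hΔ (φ := fun v => v) fun a b => continuous_id.intervalIntegrable a b]
  have := intervalIntegral.integral_comp_neg (a := 0) (b := Δ) fun v => 1 / Δ * (1 + v / Δ) * v
  rw [neg_zero] at this
  rw [← this, ← intervalIntegral.integral_add]
  · refine (intervalIntegral.integral_congr (g := fun _ => (0 : ℝ)) fun v _ => ?_).trans
      intervalIntegral.integral_zero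
    simp only
    ring
  · exact Continuous.intervalIntegrable (by fun_prop) _ _
  · exact Continuous.intervalIntegrable (by fun_prop) _ _

theorem integral_sq_ditherLaw (hΔ : 0 < Δ) : ∫ v, v ^ 2 ∂ditherLaw Δ = Δ ^ 2 / 6 := by
  rw [integral_ditherLaw hΔ fun a b => (continuous_pow 2).intervalIntegrable a b]
  have := intervalIntegral.integral_comp_neg (a := 0) (b := Δ) fun v => 1 / Δ * (1 + v / Δ) * v ^ 2
  rw [neg_zero] at this
  have h2 : ∀ v : ℝ, 1 / Δ * (1 - v / Δ) * v ^ 2 = 1 / Δ * v ^ 2 - 1 / Δ ^ 2 * v ^ 3 := by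
    intro v
    field_simp
  have h3 : ∀ v : ℝ, 1 / Δ * (1 + -v / Δ) * (-v) ^ 2 = 1 / Δ * v ^ 2 - 1 / Δ ^ 2 * v ^ 3 := by
    intro v
    field_simp
    ring
  rw [← this]
  simp only [h2, h3]
  rw [intervalIntegral.integral_sub (Continuous.intervalIntegrable (by fun_prop) _ _)
    (Continuous.intervalIntegrable (by fun_prop) _ _), intervalIntegral.integral_const_mul,
    intervalIntegral.integral_const_mul, integral_pow, integral_pow]
  field_simp
  ring

/-- The error of an infinite uniform mid-rise quantizer. -/
def roundError (Δ s : ℝ) : ℝ := Δ * (⌊s / Δ⌋ + 1 / 2) - s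

theorem roundError_eq (hΔ : 0 < Δ) (s : ℝ) : roundError Δ s = Δ / 2 - Δ * Int.fract (s / Δ) := by
  rw [roundError, Int.fract]
  field_simp
  ring

theorem measurable_roundError : Measurable (roundError Δ) := by
  unfold roundError
  have : Measurable fun s : ℝ => ((⌊s / Δ⌋ : ℤ) : ℝ) :=
    (measurable_of_countable _).comp (Int.measurable_floor.comp (measurable_id.div_const Δ))
  fun_prop

theorem abs_roundError_le (hΔ : 0 < Δ) (s : ℝ) : |roundError Δ s| ≤ Δ / 2 := by
  rw [roundError_eq hΔ, abs_le]
  have h1 := Int.fract_nonneg (s / Δ)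
  have h2 := (Int.fract_lt_one (s / Δ)).le
  constructor <;> nlinarith

theorem intervalIntegrable_roundError (hΔ : 0 < Δ) (y a b : ℝ) :
    IntervalIntegrable (fun v => roundError Δ (y + v)) volume a b := by
  refine (intervalIntegrable_const (c := Δ / 2)).mono_fun
    (measurable_roundError.comp (measurable_const_add y)).aestronglyMeasurable
    (Eventually.of_forall fun v => ?_)
  simp only [Real.norm_eq_abs, abs_of_pos (half_pos hΔ)]
  exact abs_roundError_le hΔ _

theorem roundError_periodic (hΔ : 0 < Δ) : Function.Periodic (roundError Δ) Δ := by
  intro s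
  rw [roundError_eq hΔ, roundError_eq hΔ, add_div, div_self hΔ.ne', Int.fract_add_one]

theorem integral_roundError_period (hΔ : 0 < Δ) (a : ℝ) :
    ∫ s in a..(a + Δ), roundError Δ s = 0 := by
  rw [(roundError_periodic hΔ).intervalIntegral_add_eq a 0, zero_add,
    intervalIntegral.integral_of_le hΔ.le, integral_Ioc_eq_integral_Ioo]
  have h1 : ∫ s in Set.Ioo 0 Δ, roundError Δ s = ∫ s in Set.Ioo 0 Δ, (Δ / 2 - s) := by
    refine setIntegral_congr_fun measurableSet_Ioo fun s hs => ?_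
    have : Int.fract (s / Δ) = s / Δ :=
      Int.fract_eq_self.2 ⟨div_nonneg hs.1.le hΔ.le, (div_lt_one hΔ).2 hs.2⟩
    simp only [roundError_eq hΔ, this]
    field_simp
  rw [h1, ← integral_Ioc_eq_integral_Ioo, ← intervalIntegral.integral_of_le hΔ.le,
    intervalIntegral.integral_sub (by simp) (Continuous.intervalIntegrable (by fun_prop) _ _),
    integral_id]
  simp
  ring

/-- With the triangular dither the rounding error has zero mean, whatever the input. -/
theorem integral_roundError_ditherLaw (hΔ : 0 < Δ) (y : ℝ) :
    ∫ v, roundError Δ (y + v) ∂ditherLaw Δ = 0 := by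
  have hI := intervalIntegrable_roundError hΔ y
  rw [integral_ditherLaw hΔ hI]
  -- Translating the right half of the triangle by one period onto the left half makes the weights
  -- add up to the constant `1 / Δ`, which leaves the integral over a full period.
  have h1 := intervalIntegral.integral_comp_add_right (a := -Δ) (b := 0)
    (fun v => 1 / Δ * (1 - v / Δ) * roundError Δ (y + v)) Δ
  rw [neg_add_cancel, zero_add] at h1
  have hper : ∀ v, roundError Δ (y + (v + Δ)) = roundError Δ (y + v) := fun v => by
    rw [← add_assoc, roundError_periodic hΔ]
  simp only [hper] at h1
  rw [← h1, ← intervalIntegral.integral_add]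
  · have h2 : ∀ v : ℝ, 1 / Δ * (1 + v / Δ) * roundError Δ (y + v) +
        1 / Δ * (1 - (v + Δ) / Δ) * roundError Δ (y + v) = 1 / Δ * roundError Δ (y + v) := by
      intro v
      field_simp
      ring
    simp only [h2]
    have h3 := intervalIntegral.integral_comp_add_left (a := -Δ) (b := 0) (roundError Δ) y
    have h4 := integral_roundError_period hΔ (y + -Δ)
    rw [neg_add_cancel_right] at h4
    rw [intervalIntegral.integral_const_mul, h3, add_zero, h4, mul_zero]
  · exact (hI _ _).continuousOn_mul (Continuous.continuousOn (by fun_prop))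
  · exact (hI _ _).continuousOn_mul (Continuous.continuousOn (by fun_prop))

end TriangularLaw

theorem measurable_iSup_comap {Ω : Type*} {K : ℕ} (w : ℤ → Fin K → Ω → ℝ) (n : ℤ) (k : Fin K) :
    Measurable[⨆ p : ℤ × Fin K, MeasurableSpace.comap (w p.1 p.2) inferInstance] (w n k) :=
  measurable_iff_comap_le.2
    (le_iSup (fun p : ℤ × Fin K => MeasurableSpace.comap (w p.1 p.2) inferInstance) (n, k))

/-! ### Moments of the dithered quantization error. -/

section Dither

variable {Ω : Type*} [MeasurableSpace Ω] {P : Measure Ω} {M K : ℕ}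
  {x : Fin M → ℝ → Ω → ℝ} {Δ : ℝ} {w : ℤ → Fin K → Ω → ℝ}

theorem IsDither.map_eq (hw : IsDither P x Δ w) (n : ℤ) (k : Fin K) :
    P.map (w n k) = ditherLaw Δ := hw.law n k

theorem IsDither.ae_abs_le (hw : IsDither P x Δ w) (n : ℤ) (k : Fin K) :
    ∀ᵐ ω ∂P, |w n k ω| ≤ Δ := by
  have h := ae_abs_le_ditherLaw (Δ := Δ)
  rw [← hw.map_eq n k] at h
  exact ae_of_ae_map (hw.measurable n k).aemeasurable h

theorem IsDither.indepFun (hw : IsDither P x Δ w) {β β' : Type*} [MeasurableSpace β]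
    [MeasurableSpace β'] {u : Ω → β} {v : Ω → β'}
    (hu : Measurable[⨆ p : ℤ × Fin K, MeasurableSpace.comap (w p.1 p.2) inferInstance] u)
    (hv : Measurable[inputSigma x] v) : IndepFun u v P :=
  (IndepFun_iff_Indep u v P).2 (indep_of_indep_of_le_left
    (indep_of_indep_of_le_right hw.indep_input hv.comap_le) hu.comap_le)

variable {b : ℕ} {γ : ℝ} {y z : ℤ → Fin K → Ω → ℝ}

theorem IsDitheredOutput.sub_ae_eq (hz : IsDitheredOutput P b γ y w z) (n : ℤ) (k : Fin K) :
    ∀ᵐ ω ∂P, z n k ω - y n k ω = roundError (stepSize b γ) (y n k ω + w n k ω) + w n k ω := by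
  have h1 : ∀ᵐ ω ∂P, ¬ γ ≤ |y n k ω + w n k ω| := by
    rw [ae_iff]
    simpa using hz.1 n k
  filter_upwards [h1] with ω hω
  rw [hz.2 n k ω, quantizer, if_pos (not_le.1 hω), roundError]
  ring

/-- Rounding contributes at most `Δ / 2` and the dither at most `Δ`. This crude bound suffices; the
exact error power is not needed. -/
theorem IsDitheredOutput.ae_abs_sub_le (hw : IsDither P x (stepSize b γ) w)
    (hΔ : 0 < stepSize b γ) (hz : IsDitheredOutput P b γ y w z) (n : ℤ) (k : Fin K) :
    ∀ᵐ ω ∂P, |z n k ω - y n k ω| ≤ 3 / 2 * stepSize b γ := by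
  filter_upwards [hz.sub_ae_eq n k, hw.ae_abs_le n k] with ω h1 h2
  rw [h1]
  refine (abs_add_le _ _).trans ?_
  linarith [abs_roundError_le hΔ (y n k ω + w n k ω)]

theorem IsDither.integral_eq_zero (hw : IsDither P x Δ w) (hΔ : 0 < Δ) (n : ℤ) (k : Fin K) :
    ∫ ω, w n k ω ∂P = 0 := by
  rw [← integral_id_ditherLaw hΔ, ← hw.map_eq n k,
    integral_map (f := fun v => v) (hw.measurable n k).aemeasurable aestronglyMeasurable_id]

theorem IsDither.integral_sq (hw : IsDither P x Δ w) (hΔ : 0 < Δ) (n : ℤ) (k : Fin K) :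
    ∫ ω, w n k ω ^ 2 ∂P = Δ ^ 2 / 6 := by
  rw [← integral_sq_ditherLaw hΔ, ← hw.map_eq n k,
    integral_map (hw.measurable n k).aemeasurable (continuous_pow 2).aestronglyMeasurable]

variable [IsProbabilityMeasure P]

theorem IsDither.memLp (hw : IsDither P x Δ w) (n : ℤ) (k : Fin K) : MemLp (w n k) 2 P :=
  MemLp.of_bound (hw.measurable n k).aestronglyMeasurable Δ (hw.ae_abs_le n k)

/-- The cross term vanishes by independence and zero mean. Independence is first read off for an
`inputSigma x`-measurable version of `Y`. -/
theorem IsDither.integral_add_sq (hw : IsDither P x Δ w) (hΔ : 0 < Δ) {Y : Ω → ℝ}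
    (hY : MemLp Y 2 P) (hYm : AEStronglyMeasurable[inputSigma x] Y P) (n : ℤ) (k : Fin K) :
    ∫ ω, (Y ω + w n k ω) ^ 2 ∂P = (∫ ω, Y ω ^ 2 ∂P) + Δ ^ 2 / 6 := by
  obtain ⟨Y', hY', hYY'⟩ := hYm
  have hind : IndepFun (w n k) Y' P :=
    hw.indepFun (measurable_iSup_comap w n k) hY'.measurable
  have hind' : IndepFun (w n k) Y P := hind.congr EventuallyEq.rfl hYY'.symm
  have h0 : ∫ ω, w n k ω * Y ω ∂P = 0 := by
    rw [hind'.integral_fun_mul_eq_mul_integral (hw.measurable n k).aestronglyMeasurable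
      hY.aestronglyMeasurable, hw.integral_eq_zero hΔ, zero_mul]
  have hI : Integrable (fun ω => 2 * (w n k ω * Y ω)) P :=
    (integrable_mul_of_memLp (hw.memLp n k) hY).const_mul 2
  have hI' : Integrable (fun ω => 2 * (w n k ω * Y ω) + w n k ω ^ 2) P :=
    hI.add (hw.memLp n k).integrable_sq
  have h1 : ∀ ω, (Y ω + w n k ω) ^ 2 = Y ω ^ 2 + (2 * (w n k ω * Y ω) + w n k ω ^ 2) := fun ω => by
    ring
  simp only [h1]
  rw [integral_add hY.integrable_sq hI',
    integral_add hI (hw.memLp n k).integrable_sq, integral_const_mul, h0,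
    hw.integral_sq hΔ]
  ring

theorem IsDitheredOutput.memLp_sub (hw : IsDither P x (stepSize b γ) w)
    (hΔ : 0 < stepSize b γ) (hz : IsDitheredOutput P b γ y w z)
    (hy : ∀ n k, AEStronglyMeasurable (y n k) P) (n : ℤ) (k : Fin K) :
    MemLp (fun ω => z n k ω - y n k ω) 2 P := by
  refine MemLp.of_bound ?_ _ (hz.ae_abs_sub_le hw hΔ n k)
  have hm := (hw.measurable n k).aemeasurable (μ := P)
  have h1 := ((measurable_roundError (Δ := stepSize b γ)).comp_aemeasurable
    ((hy n k).aemeasurable.add hm)).add hm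
  refine (h1.congr ?_).aestronglyMeasurable
  exact EventuallyEq.symm (hz.sub_ae_eq n k)

theorem IsDitheredOutput.integral_sq_le (hw : IsDither P x (stepSize b γ) w)
    (hΔ : 0 < stepSize b γ) (hz : IsDitheredOutput P b γ y w z) (n : ℤ) (k : Fin K) :
    ∫ ω, (z n k ω - y n k ω) ^ 2 ∂P ≤ 9 / 4 * stepSize b γ ^ 2 := by
  have h1 : ∫ ω, (z n k ω - y n k ω) ^ 2 ∂P ≤ ∫ _, 9 / 4 * stepSize b γ ^ 2 ∂P := by
    refine integral_mono_of_nonneg (Eventually.of_forall fun ω => sq_nonneg _)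
      (integrable_const _) ?_
    filter_upwards [hz.ae_abs_sub_le hw hΔ n k] with ω hω
    have h2 := abs_le.1 hω
    nlinarith [h2.1, h2.2]
  simpa using h1

/-- For fixed values of the possibly dependent inputs `Y`, `Y'`, the two dithers are still
independent with law `ν`; the inner integral factors, and its first factor is zero. -/
theorem integral_mul_eq_zero_of_indepFun {g : ℝ → ℝ → ℝ} (hg : Measurable (Function.uncurry g))
    {ν : Measure ℝ} [IsProbabilityMeasure ν] (hmean : ∀ c, ∫ a, g a c ∂ν = 0) {U U' Y Y' : Ω → ℝ}
    (hU : Measurable U) (hU' : Measurable U') (hY : Measurable Y) (hY' : Measurable Y')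
    (hUν : P.map U = ν) (hUν' : P.map U' = ν) (hUU : IndepFun U U' P)
    (hind : IndepFun (fun ω => (U ω, U' ω)) (fun ω => (Y ω, Y' ω)) P)
    (hint : Integrable (fun ω => g (U ω) (Y ω) * g (U' ω) (Y' ω)) P) :
    ∫ ω, g (U ω) (Y ω) * g (U' ω) (Y' ω) ∂P = 0 := by
  let Φ : (ℝ × ℝ) × (ℝ × ℝ) → ℝ := fun p => g p.1.1 p.2.1 * g p.1.2 p.2.2
  have hΦ : Measurable Φ := by
    have h1 : Measurable fun p : (ℝ × ℝ) × (ℝ × ℝ) => g p.1.1 p.2.1 :=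
      hg.comp (by fun_prop : Measurable fun p : (ℝ × ℝ) × (ℝ × ℝ) => (p.1.1, p.2.1))
    have h2 : Measurable fun p : (ℝ × ℝ) × (ℝ × ℝ) => g p.1.2 p.2.2 :=
      hg.comp (by fun_prop : Measurable fun p : (ℝ × ℝ) × (ℝ × ℝ) => (p.1.2, p.2.2))
    exact h1.mul h2
  let T : Ω → (ℝ × ℝ) × (ℝ × ℝ) := fun ω => ((U ω, U' ω), (Y ω, Y' ω))
  have hUm := hU.prodMk hU'
  have hYm := hY.prodMk hY'
  have hT : Measurable T := hUm.prodMk hYm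
  have hmap : P.map T = (ν.prod ν).prod (P.map fun ω => (Y ω, Y' ω)) := by
    rw [(indepFun_iff_map_prod_eq_prod_map_map hUm.aemeasurable hYm.aemeasurable).1 hind,
      (indepFun_iff_map_prod_eq_prod_map_map hU.aemeasurable hU'.aemeasurable).1 hUU, hUν, hUν']
  have hint' : Integrable Φ (P.map T) :=
    (integrable_map_measure hΦ.aestronglyMeasurable hT.aemeasurable).2 hint
  have h3 : ∫ ω, g (U ω) (Y ω) * g (U' ω) (Y' ω) ∂P = ∫ p, Φ p ∂(P.map T) :=
    (integral_map hT.aemeasurable hΦ.aestronglyMeasurable).symm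
  rw [h3]
  rw [hmap] at hint' ⊢
  have : IsProbabilityMeasure (P.map fun ω => (Y ω, Y' ω)) :=
    Measure.isProbabilityMeasure_map hYm.aemeasurable
  rw [integral_prod_symm _ hint']
  refine integral_eq_zero_of_ae (Eventually.of_forall fun c => ?_)
  simp only [Φ]
  rw [integral_prod_mul (fun a => g a c.1) (fun a => g a c.2), hmean, zero_mul, Pi.zero_apply]

/-- The error of a dithered quantizer as a function of the dither `a` and the input `c`. -/
def ditherError (Δ a c : ℝ) : ℝ := roundError Δ (c + a) + a

theorem measurable_ditherError : Measurable (Function.uncurry (ditherError Δ)) :=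
  (measurable_roundError.comp (measurable_snd.add measurable_fst)).add measurable_fst

theorem integral_ditherError (hΔ : 0 < Δ) [IsProbabilityMeasure (ditherLaw Δ)] (c : ℝ) :
    ∫ a, ditherError Δ a c ∂ditherLaw Δ = 0 := by
  have hb : Integrable (fun a => roundError Δ (c + a)) (ditherLaw Δ) :=
    Integrable.of_bound (measurable_roundError.comp
      (measurable_const_add c)).aestronglyMeasurable (Δ / 2)
      (Eventually.of_forall fun a => abs_roundError_le hΔ _)
  have hi : Integrable (fun a : ℝ => a) (ditherLaw Δ) :=
    Integrable.of_bound aestronglyMeasurable_id Δ ae_abs_le_ditherLaw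
  unfold ditherError
  rw [integral_add hb hi, integral_roundError_ditherLaw hΔ, integral_id_ditherLaw hΔ, add_zero]

/-- The errors of different dithered quantizers are uncorrelated. -/
theorem IsDitheredOutput.integral_mul_eq_zero (hw : IsDither P x (stepSize b γ) w)
    (hΔ : 0 < stepSize b γ) (hz : IsDitheredOutput P b γ y w z)
    (hy : ∀ n k, AEStronglyMeasurable[inputSigma x] (y n k) P) {n n' : ℤ} {k k' : Fin K}
    (hne : (n, k) ≠ (n', k')) (hle : inputSigma x ≤ ‹MeasurableSpace Ω›) :
    ∫ ω, (z n k ω - y n k ω) * (z n' k' ω - y n' k' ω) ∂P = 0 := by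
  have hzm := fun n k => hz.memLp_sub hw hΔ (fun n k => (hy n k).mono hle) n k
  obtain ⟨Y, hY, hyY⟩ := hy n k
  obtain ⟨Y', hY', hyY'⟩ := hy n' k'
  have hae : (fun ω => (z n k ω - y n k ω) * (z n' k' ω - y n' k' ω)) =ᵐ[P] fun ω =>
      ditherError (stepSize b γ) (w n k ω) (Y ω) *
        ditherError (stepSize b γ) (w n' k' ω) (Y' ω) := by
    filter_upwards [hz.sub_ae_eq n k, hz.sub_ae_eq n' k', hyY, hyY'] with ω h1 h2 h3 h4
    rw [h1, h2, h3, h4, ditherError, ditherError]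
  have hprob : IsProbabilityMeasure (ditherLaw (stepSize b γ)) := by
    rw [← hw.map_eq n k]
    exact Measure.isProbabilityMeasure_map (hw.measurable n k).aemeasurable
  have hind : IndepFun (fun ω => (w n k ω, w n' k' ω)) (fun ω => (Y ω, Y' ω)) P :=
    hw.indepFun ((measurable_iSup_comap w n k).prodMk (measurable_iSup_comap w n' k'))
      (hY.measurable.prodMk hY'.measurable)
  have hindw : IndepFun (w n k) (w n' k') P := hw.iIndep.indepFun hne
  rw [integral_congr_ae hae]
  exact integral_mul_eq_zero_of_indepFun measurable_ditherError (integral_ditherError hΔ)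
    (hw.measurable n k) (hw.measurable n' k') (hY.measurable.mono hle le_rfl)
    (hY'.measurable.mono hle le_rfl) (hw.map_eq n k) (hw.map_eq n' k') hindw hind
    ((integrable_mul_of_memLp (hzm n k) (hzm n' k')).congr hae)

end Dither

/-! ### Recovery of a continuous signal from noisy samples. -/

section Recoverable

variable {F : Type*} [NormedAddCommGroup F] [InnerProductSpace ℝ F]

/-- `Z` is approximated arbitrarily well by the subspaces `S Ts` as `Ts` tends to zero. -/
def Recoverable (S : ℝ → Submodule ℝ F) (Z : F) : Prop :=
  ∀ ε > 0, ∀ᶠ Ts : ℝ in 𝓝[>] 0, ∃ s ∈ S Ts, ‖Z - s‖ < ε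

variable {S : ℝ → Submodule ℝ F}

theorem Recoverable.zero : Recoverable S 0 := fun ε hε =>
  Eventually.of_forall fun Ts => ⟨0, (S Ts).zero_mem, by simpa using hε⟩

theorem Recoverable.add {Z Z' : F} (h : Recoverable S Z) (h' : Recoverable S Z') :
    Recoverable S (Z + Z') := by
  intro ε hε
  filter_upwards [h _ (half_pos hε), h' _ (half_pos hε)] with Ts ⟨s, hs, h1⟩ ⟨s', hs', h2⟩
  refine ⟨s + s', (S Ts).add_mem hs hs', ?_⟩
  rw [add_sub_add_comm]
  exact (norm_add_le _ _).trans_lt (by linarith)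

theorem Recoverable.smul {Z : F} (h : Recoverable S Z) (a : ℝ) : Recoverable S (a • Z) := by
  intro ε hε
  have ha : 0 < |a| + 1 := by positivity
  filter_upwards [h _ (div_pos hε ha)] with Ts ⟨s, hs, h1⟩
  refine ⟨a • s, (S Ts).smul_mem a hs, ?_⟩
  rw [← smul_sub, norm_smul, Real.norm_eq_abs]
  rw [lt_div_iff₀ ha] at h1
  nlinarith [norm_nonneg (Z - s)]

theorem Recoverable.of_mem_closure {V : Set F} (hV : ∀ Z ∈ V, Recoverable S Z) {Z : F}
    (hZ : Z ∈ (Submodule.span ℝ V).topologicalClosure) : Recoverable S Z := by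
  have hspan : ∀ Z ∈ Submodule.span ℝ V, Recoverable S Z := fun Z hZ =>
    Submodule.span_induction (p := fun Z _ => Recoverable S Z) hV Recoverable.zero
      (fun _ _ _ _ h h' => h.add h') (fun a _ _ h => h.smul a) hZ
  rw [← SetLike.mem_coe, Submodule.topologicalClosure_coe, Metric.mem_closure_iff] at hZ
  intro ε hε
  obtain ⟨W, hW, hdist⟩ := hZ _ (half_pos hε)
  filter_upwards [hspan W hW _ (half_pos hε)] with Ts ⟨s, hs, h1⟩
  refine ⟨s, hs, ?_⟩
  rw [dist_eq_norm] at hdist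
  rw [← sub_add_sub_cancel Z W s]
  exact (norm_add_le _ _).trans_lt (by linarith)

theorem norm_sq_sum_of_orthogonal {ι : Type*} {v : ι → F} (s : Finset ι)
    (h : ∀ i j, i ≠ j → inner ℝ (v i) (v j) = 0) : ‖∑ i ∈ s, v i‖ ^ 2 = ∑ i ∈ s, ‖v i‖ ^ 2 := by
  rw [← real_inner_self_eq_norm_sq, sum_inner]
  refine Finset.sum_congr rfl fun i hi => ?_
  rw [inner_sum, Finset.sum_eq_single_of_mem i hi fun j _ hj => h i j hj.symm,
    real_inner_self_eq_norm_sq]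

/-- A continuous signal is recovered from its samples in orthogonal noise of amplitude proportional
to the sampling period, by averaging the samples over a short window. -/
theorem recoverable_of_samples {Y : ℝ → F} (hY : Continuous Y) {Z : ℝ → ℤ → F} {c : ℝ}
    (hnorm : ∀ Ts > 0, ∀ n, ‖Z Ts n - Ts • Y (n * Ts)‖ ^ 2 ≤ c * Ts ^ 2)
    (horth : ∀ Ts > 0, ∀ n n', n ≠ n' →
      inner ℝ (Z Ts n - Ts • Y (n * Ts)) (Z Ts n' - Ts • Y (n' * Ts)) = 0)
    (hZ : ∀ Ts > 0, ∀ n, Z Ts n ∈ S Ts) (t : ℝ) : Recoverable S (Y t) := by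
  intro ε hε
  obtain ⟨δ, hδ, hcont⟩ := Metric.continuousAt_iff.1 hY.continuousAt (ε / 2) (half_pos hε)
  have hbig : Tendsto (fun Ts : ℝ => δ / 2 * Ts⁻¹) (𝓝[>] 0) atTop :=
    tendsto_inv_nhdsGT_zero.const_mul_atTop (half_pos hδ)
  -- The average of `m` orthogonal errors, rescaled by `1 / Ts`, has squared norm at most `c / m`,
  -- which is below `(ε / 2) ^ 2` once `m > 4 c / ε²`. The added `1` absorbs the floor in `m`; the
  -- second threshold gives `m ≥ 1`.
  filter_upwards [self_mem_nhdsWithin, hbig.eventually_gt_atTop (4 * c / ε ^ 2 + 1),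
    hbig.eventually_gt_atTop 1] with Ts hTs hm1 hm2
  have hT : 0 < Ts := hTs
  set m : ℕ := ⌊δ / 2 * Ts⁻¹⌋₊ with hm
  have hmle : (m : ℝ) ≤ δ / 2 * Ts⁻¹ := Nat.floor_le (by positivity)
  have hmlt : δ / 2 * Ts⁻¹ < m + 1 := Nat.lt_floor_add_one _
  have hm0 : 0 < (m : ℝ) := by
    have : 1 ≤ m := (Nat.one_le_floor_iff _).2 hm2.le
    exact_mod_cast this
  have hmT : m * Ts ≤ δ / 2 := by
    calc m * Ts ≤ δ / 2 * Ts⁻¹ * Ts := mul_le_mul_of_nonneg_right hmle hT.le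
      _ = δ / 2 := inv_mul_cancel_right₀ hT.ne' _
  -- The window starts at the first sample not before `t`, so its `i`-th point is within `(i + 1) Ts
  -- ≤ m Ts ≤ δ / 2` of `t`.
  set n₀ : ℤ := ⌈t / Ts⌉ with hn₀
  have hn1 : t ≤ n₀ * Ts := (div_le_iff₀ hT).1 (Int.le_ceil _)
  have hn2 : n₀ * Ts < t + Ts := by
    have h1 := Int.ceil_lt_add_one (t / Ts)
    have h2 := mul_lt_mul_of_pos_right h1 hT
    rwa [add_mul, div_mul_cancel₀ _ hT.ne', one_mul] at h2
  let e : ℕ → F := fun i => Z Ts (n₀ + i) - Ts • Y ((n₀ + i : ℤ) * Ts)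
  have hnear : ∀ i ∈ Finset.range m, ‖Y t - Y ((n₀ + i : ℤ) * Ts)‖ ≤ ε / 2 := by
    intro i hi
    have hi' : (i : ℝ) + 1 ≤ m := by exact_mod_cast Finset.mem_range.1 hi
    have h1 : ((n₀ + i : ℤ) : ℝ) * Ts = n₀ * Ts + i * Ts := by push_cast; ring
    have h2 : (i + 1) * Ts ≤ m * Ts := mul_le_mul_of_nonneg_right hi' hT.le
    have h3 : 0 ≤ i * Ts := by positivity
    rw [← dist_eq_norm, dist_comm]
    refine (hcont ?_).le
    rw [Real.dist_eq, h1, abs_of_nonneg (by linarith)]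
    linarith
  have hnoise : ‖∑ i ∈ Finset.range m, e i‖ ^ 2 ≤ m * (c * Ts ^ 2) := by
    rw [norm_sq_sum_of_orthogonal]
    · have h1 : ∀ i ∈ Finset.range m, ‖e i‖ ^ 2 ≤ c * Ts ^ 2 := fun i _ => hnorm Ts hT (n₀ + i)
      refine (Finset.sum_le_sum h1).trans ?_
      simp
    · exact fun i j hij => horth Ts hT _ _ (by simpa using hij)
  refine ⟨(m * Ts)⁻¹ • ∑ i ∈ Finset.range m, Z Ts (n₀ + i), (S Ts).smul_mem _
    ((S Ts).sum_mem fun i _ => hZ Ts hT _), ?_⟩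
  have hsplit : Y t - (m * Ts)⁻¹ • ∑ i ∈ Finset.range m, Z Ts (n₀ + i) =
      (m : ℝ)⁻¹ • ∑ i ∈ Finset.range m, (Y t - Y ((n₀ + i : ℤ) * Ts)) -
        (m * Ts)⁻¹ • ∑ i ∈ Finset.range m, e i := by
    simp only [e, Finset.sum_sub_distrib, smul_sub, ← Finset.smul_sum, smul_smul, Finset.sum_const,
      Finset.card_range, ← Nat.cast_smul_eq_nsmul ℝ]
    rw [inv_mul_cancel₀ hm0.ne', one_smul, mul_inv, inv_mul_cancel_right₀ hT.ne']
    abel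
  have hA : ‖(m : ℝ)⁻¹ • ∑ i ∈ Finset.range m, (Y t - Y ((n₀ + i : ℤ) * Ts))‖ ≤ ε / 2 := by
    rw [norm_smul, norm_inv, Real.norm_of_nonneg hm0.le, inv_mul_le_iff₀ hm0]
    refine (norm_sum_le _ _).trans ((Finset.sum_le_sum hnear).trans ?_)
    simp
  have hB : ‖(m * Ts)⁻¹ • ∑ i ∈ Finset.range m, e i‖ < ε / 2 := by
    rw [norm_smul, norm_inv, Real.norm_of_nonneg (by positivity), inv_mul_lt_iff₀ (by positivity)]
    refine lt_of_pow_lt_pow_left₀ 2 (by positivity) (hnoise.trans_lt ?_)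
    have h1 : 4 * c / ε ^ 2 < m := by linarith
    rw [div_lt_iff₀ (by positivity)] at h1
    have h2 : (m * Ts * (ε / 2)) ^ 2 = m * Ts ^ 2 * (m * ε ^ 2 / 4) := by ring
    have h3 : m * (c * Ts ^ 2) = m * Ts ^ 2 * c := by ring
    rw [h2, h3]
    exact mul_lt_mul_of_pos_left (by linarith) (by positivity)
  rw [hsplit]
  exact (norm_sub_le _ _).trans_lt (by linarith)

end Recoverable

/-! ### From approximation in `L²` to the achievable MSE. -/

section Achievable

variable {Ω : Type*} [MeasurableSpace Ω] {P : Measure Ω} {K N : ℕ}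

/-- The subspace of the finite linear combinations of the quantizer outputs. -/
def outputSpan (P : Measure Ω) (z : ℤ → Fin K → Ω → ℝ) : Submodule ℝ (Lp ℝ 2 P) :=
  Submodule.span ℝ {Z | ∃ n k, Z =ᵐ[P] z n k}

theorem exists_finsupp_of_mem_outputSpan {z : ℤ → Fin K → Ω → ℝ} {Z : Lp ℝ 2 P}
    (hZ : Z ∈ outputSpan P z) :
    ∃ c : ℤ × Fin K →₀ ℝ, Z =ᵐ[P] fun ω => c.sum fun p a => a * z p.1 p.2 ω := by
  refine Submodule.span_induction (p := fun (Z : Lp ℝ 2 P) _ => ∃ c : ℤ × Fin K →₀ ℝ,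
    Z =ᵐ[P] fun ω => c.sum fun p a => a * z p.1 p.2 ω) ?_ ?_ ?_ ?_ hZ
  · rintro Z ⟨n, k, h⟩
    refine ⟨Finsupp.single (n, k) 1, h.trans (Eventually.of_forall fun ω => ?_)⟩
    simp [Finsupp.sum_single_index]
  · refine ⟨0, (Lp.coeFn_zero ℝ 2 P).trans (Eventually.of_forall fun ω => ?_)⟩
    simp
  · rintro Z Z' _ _ ⟨c, hc⟩ ⟨c', hc'⟩
    refine ⟨c + c', ?_⟩
    filter_upwards [Lp.coeFn_add Z Z', hc, hc'] with ω h1 h2 h3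
    rw [h1, Pi.add_apply, h2, h3, Finsupp.sum_add_index' (by simp) (by intros; ring)]
  · rintro a Z _ ⟨c, hc⟩
    refine ⟨a • c, ?_⟩
    filter_upwards [Lp.coeFn_smul a Z, hc] with ω h1 h2
    rw [h1, Pi.smul_apply, h2, Finsupp.sum_smul_index' (by simp), Finsupp.smul_sum]
    simp [mul_assoc]

theorem achievableMSE_nonneg (st : Fin N → Ω → ℝ) (z : ℤ → Fin K → Ω → ℝ) :
    0 ≤ achievableMSE P st z := by
  refine Real.sInf_nonneg ?_
  rintro r ⟨G, shat, -, rfl⟩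
  exact integral_nonneg fun ω => Finset.sum_nonneg fun i _ => sq_nonneg _

/-- A finite combination of outputs comes from a finitely supported digital filter, whose partial
sums are eventually exact. -/
theorem achievableMSE_le {st : Fin N → Ω → ℝ} (hst : ∀ i, MemLp (st i) 2 P)
    {z : ℤ → Fin K → Ω → ℝ} {s : Fin N → Lp ℝ 2 P} (hs : ∀ i, s i ∈ outputSpan P z) :
    achievableMSE P st z ≤ ∑ i, ‖(hst i).toLp (st i) - s i‖ ^ 2 := by
  classical
  choose c hc using fun i => exists_finsupp_of_mem_outputSpan (hs i)
  let shat : Fin N → Ω → ℝ := fun i ω => (c i).sum fun p a => a * z p.1 p.2 ω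
  have hshat : ∀ i, MemLp (shat i) 2 P := fun i => (memLp_congr_ae (hc i)).1 (Lp.memLp (s i))
  refine csInf_le ⟨0, ?_⟩ ⟨fun n => Matrix.of fun i k => c i (-n, k), shat, fun i => ⟨hshat i, ?_⟩, ?_⟩
  · rintro r ⟨G, shat, -, rfl⟩
    exact integral_nonneg fun ω => Finset.sum_nonneg fun i _ => sq_nonneg _
  · refine tendsto_const_nhds.congr' ?_
    filter_upwards [eventually_ge_atTop ((c i).support.image Prod.fst)] with A hA
    have h0 : (fun ω => shat i ω - ∑ n ∈ A, ∑ k, (Matrix.of fun (i : Fin N) (k : Fin K) =>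
        c i (- -n, k)) i k * z n k ω) = 0 := by
      funext ω
      have hsub : (c i).support ⊆ A ×ˢ (Finset.univ : Finset (Fin K)) := fun p hp =>
        Finset.mem_product.2 ⟨hA (Finset.mem_image_of_mem _ hp), Finset.mem_univ _⟩
      simp only [shat, Pi.zero_apply, Matrix.of_apply, neg_neg]
      rw [Finsupp.sum_of_support_subset _ hsub _ (by simp), Finset.sum_product, sub_self]
    rw [h0, eLpNorm_zero]
  · have hI : ∀ i, Integrable (fun ω => (st i ω - shat i ω) ^ 2) P := fun i =>
      ((hst i).sub (hshat i)).integrable_sq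
    rw [integral_finsetSum _ fun i _ => hI i]
    refine Finset.sum_congr rfl fun i _ => ?_
    have h1 : s i = (hshat i).toLp (shat i) := by
      refine Lp.ext ((hc i).trans (hshat i).coeFn_toLp.symm)
    rw [h1, ← MemLp.toLp_sub, ← real_inner_self_eq_norm_sq, real_inner_toLp]
    simp only [Pi.sub_apply, pow_two]

theorem tendsto_achievableMSE {st : Fin N → Ω → ℝ} (hst : ∀ i, MemLp (st i) 2 P)
    {z : ℝ → ℤ → Fin K → Ω → ℝ}
    (h : ∀ i, Recoverable (fun Ts => outputSpan P (z Ts)) ((hst i).toLp (st i))) :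
    Tendsto (fun Ts => achievableMSE P st (z Ts)) (𝓝[>] 0) (𝓝 0) := by
  rw [Metric.tendsto_nhds]
  intro ε hε
  -- Dividing by `N + 1` instead of `N` covers `N = 0` and keeps the final inequality strict.
  have hε' : 0 < √(ε / (N + 1)) := Real.sqrt_pos.2 (by positivity)
  filter_upwards [eventually_all.2 fun i => h i _ hε'] with Ts hTs
  choose s hs hn using hTs
  rw [Real.dist_0_eq_abs, abs_of_nonneg (achievableMSE_nonneg _ _)]
  refine (achievableMSE_le hst hs).trans_lt ?_
  have h1 : ∀ i, ‖(hst i).toLp (st i) - s i‖ ^ 2 ≤ ε / (N + 1) := fun i => by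
    rw [← Real.sq_sqrt (by positivity : 0 ≤ ε / ((N : ℝ) + 1))]
    exact pow_le_pow_left₀ (norm_nonneg _) (hn i).le 2
  refine (Finset.sum_le_sum fun i _ => h1 i).trans_lt ?_
  rw [Finset.sum_const, Finset.card_univ, Fintype.card_fin, nsmul_eq_mul, mul_div_assoc',
    div_lt_iff₀ (by positivity)]
  linarith

end Achievable

/-! ### The dynamic range rule and the recovery of filter outputs. -/

section Quantization

variable {Ω : Type*} [MeasurableSpace Ω] {P : Measure Ω} [IsProbabilityMeasure P]
  {M K : ℕ} {x : Fin M → ℝ → Ω → ℝ} {C : ℝ → Matrix (Fin M) (Fin M) ℂ}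
  {H : ℝ → Matrix (Fin K) (Fin M) ℂ} {y : Fin K → ℝ → Ω → ℝ}

theorem stepSize_pos {b : ℕ} {γ : ℝ} (hγ : 0 < γ) : 0 < stepSize b γ := by
  unfold stepSize
  positivity

theorem integral_sample_sq (hx : IsWSS P x C) (hH : ∀ k m, Measurable fun f => H f k m)
    (hy : ∀ t, IsFilterOutput P x C H t fun k => y k t) (Ts : ℝ) (n : ℤ) (k : Fin K) :
    ∫ ω, sample y Ts n k ω ^ 2 ∂P = Ts ^ 2 * ∫ ω, y k 0 ω ^ 2 ∂P := by
  simp only [sample, mul_pow]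
  rw [integral_const_mul, (hy (n * Ts)).integral_sq_eq hx hH k, (hy 0).integral_sq_eq hx hH k]

/-- The dynamic range rule makes the step size at most proportional to the sampling period, unless
the quantizers have no input. -/
theorem stepSize_sq_le_or (hK : 1 ≤ K) (hx : IsWSS P x C)
    (hH : ∀ k m, Measurable fun f => H f k m)
    (hy : ∀ t, IsFilterOutput P x C H t fun k => y k t)
    {b : ℕ} {η : ℝ} (hη : 0 < η) {γ : ℝ → ℝ} {w : ℝ → ℤ → Fin K → Ω → ℝ}
    (hw : ∀ Ts > 0, IsDither P x (stepSize b (γ Ts)) (w Ts))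
    (hγ : ∀ Ts > 0, IsDynamicRange P η (γ Ts) (sample y Ts) (w Ts)) :
    (∃ c, ∀ Ts > 0, stepSize b (γ Ts) ^ 2 ≤ c * Ts ^ 2) ∨ ∀ k, ∫ ω, y k 0 ω ^ 2 ∂P = 0 := by
  by_cases hzero : ∀ k, ∫ ω, y k 0 ω ^ 2 ∂P = 0
  · exact Or.inr hzero
  left
  set σ : Fin K → ℝ := fun k => ∫ ω, y k 0 ω ^ 2 ∂P with hσ
  have hσ0 : ∀ k, 0 ≤ σ k := fun k => integral_nonneg fun ω => sq_nonneg _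
  -- Since `γ = 2 ^ b Δ / 2` and the dither has variance `Δ² / 6`, the rule reads `a Δ² = Ts² max
  -- σ`, with `a` independent of `Ts`.
  set a : ℝ := (2 ^ b) ^ 2 / (4 * η ^ 2) - 1 / 6 with ha
  have : Nonempty (Fin K) := ⟨⟨0, hK⟩⟩
  have key : ∀ Ts > 0, (∀ k, Ts ^ 2 * σ k ≤ a * stepSize b (γ Ts) ^ 2) ∧
      ∃ k, a * stepSize b (γ Ts) ^ 2 = Ts ^ 2 * σ k := by
    intro Ts hTs
    obtain ⟨hpos, hrange⟩ := hγ Ts hTs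
    have hΔ := stepSize_pos (b := b) hpos
    have h1 : ∀ k, ∫ ω, (sample y Ts 0 k ω + w Ts 0 k ω) ^ 2 ∂P =
        Ts ^ 2 * σ k + stepSize b (γ Ts) ^ 2 / 6 := fun k => by
      have hm : AEStronglyMeasurable[inputSigma x] (sample y Ts 0 k) P :=
        ((hy ((0 : ℤ) * Ts)).aestronglyMeasurable_inputSigma hx hH k).const_mul Ts
      have hL : MemLp (sample y Ts 0 k) 2 P := ((hy ((0 : ℤ) * Ts)).1 k).const_mul Ts
      rw [(hw Ts hTs).integral_add_sq hΔ hL hm,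
        integral_sample_sq hx hH hy]
    have h2 := hrange 0
    simp only [h1] at h2
    have h3 : γ Ts ^ 2 / η ^ 2 = a * stepSize b (γ Ts) ^ 2 + stepSize b (γ Ts) ^ 2 / 6 := by
      rw [ha, stepSize]
      field_simp
      ring
    have h4 : ⨆ k, (Ts ^ 2 * σ k + stepSize b (γ Ts) ^ 2 / 6) = γ Ts ^ 2 / η ^ 2 := by
      rw [h2, mul_div_cancel_left₀ _ (by positivity)]
    rw [h3] at h4
    refine ⟨fun k => ?_, ?_⟩
    · have := le_ciSup (f := fun k => Ts ^ 2 * σ k + stepSize b (γ Ts) ^ 2 / 6)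
        (Set.finite_range _).bddAbove k
      rw [h4] at this
      linarith
    · obtain ⟨k, hk⟩ := exists_eq_ciSup_of_finite
        (f := fun k => Ts ^ 2 * σ k + stepSize b (γ Ts) ^ 2 / 6)
      rw [h4] at hk
      exact ⟨k, by linarith⟩
  obtain ⟨k₁, hk₁⟩ := not_forall.1 hzero
  have hk₁' : 0 < σ k₁ := lt_of_le_of_ne (hσ0 k₁) (Ne.symm hk₁)
  -- The rule at the single period `Ts = 1`, together with a nonzero output power, forces this sign;
  -- no condition on `η` and `b` is imposed.
  have ha0 : 0 < a := by
    have h1 := (key 1 one_pos).1 k₁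
    have h2 : 0 < a * stepSize b (γ 1) ^ 2 := by linarith
    exact pos_of_mul_pos_left h2 (sq_nonneg _)
  refine ⟨(∑ k, σ k) / a, fun Ts hTs => ?_⟩
  obtain ⟨k, hk⟩ := (key Ts hTs).2
  have h1 : σ k ≤ ∑ k, σ k := Finset.single_le_sum (fun k _ => hσ0 k) (Finset.mem_univ k)
  rw [div_mul_eq_mul_div, le_div_iff₀ ha0, mul_comm, hk, mul_comm]
  exact mul_le_mul_of_nonneg_right h1 (sq_nonneg _)

/-- Under both quantizer models the quantization errors have power at most proportional to the
squared step size and are uncorrelated in time. -/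
theorem quantizationError_bounds (hx : IsWSS P x C) (hH : ∀ k m, Measurable fun f => H f k m)
    (hy : ∀ t, IsFilterOutput P x C H t fun k => y k t) {b : ℕ} {γ Ts : ℝ} (hγ : 0 < γ)
    {w z : ℤ → Fin K → Ω → ℝ} (hw : IsDither P x (stepSize b γ) w)
    (hz : IsAdditiveOutput P (stepSize b γ) (sample y Ts) z ∨
      IsDitheredOutput P b γ (sample y Ts) w z) :
    (∀ n k, MemLp (fun ω => z n k ω - sample y Ts n k ω) 2 P) ∧
    (∀ n k, ∫ ω, (z n k ω - sample y Ts n k ω) ^ 2 ∂P ≤ 9 / 4 * stepSize b γ ^ 2) ∧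
    ∀ n n' k, n ≠ n' →
      ∫ ω, (z n k ω - sample y Ts n k ω) * (z n' k ω - sample y Ts n' k ω) ∂P = 0 := by
  have hΔ := stepSize_pos (b := b) hγ
  have hm : ∀ n k, AEStronglyMeasurable[inputSigma x] (sample y Ts n k) P := fun n k =>
    ((hy (n * Ts)).aestronglyMeasurable_inputSigma hx hH k).const_mul Ts
  rcases hz with hz | hz
  · refine ⟨fun n k => hz.memLp n k, fun n k => ?_, fun n n' k hne => ?_⟩
    · have h1 := hz.autocorrelation n 0 k k
      simp only [add_zero, and_self, if_true] at h1
      simp only [pow_two (_ - _), h1]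
      linarith [sq_nonneg (stepSize b γ)]
    · have h1 := hz.autocorrelation n' (n - n') k k
      rw [if_neg fun h => hne (sub_eq_zero.1 h.1)] at h1
      simpa only [add_sub_cancel] using h1
  · exact ⟨hz.memLp_sub hw hΔ fun n k => (hm n k).mono (inputSigma_le hx),
      hz.integral_sq_le hw hΔ, fun n n' k hne => hz.integral_mul_eq_zero hw hΔ hm
        (fun h => hne (congrArg Prod.fst h)) (inputSigma_le hx)⟩

theorem recoverable_output (hx : IsWSS P x C) (hH : ∀ k m, Measurable fun f => H f k m)
    (hy : ∀ t, IsFilterOutput P x C H t fun k => y k t) {z : ℝ → ℤ → Fin K → Ω → ℝ} {c : ℝ}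
    (hmem : ∀ Ts > 0, ∀ n k, MemLp (fun ω => z Ts n k ω - sample y Ts n k ω) 2 P)
    (hpow : ∀ Ts > 0, ∀ n k, ∫ ω, (z Ts n k ω - sample y Ts n k ω) ^ 2 ∂P ≤ c * Ts ^ 2)
    (horth : ∀ Ts > 0, ∀ n n' k, n ≠ n' →
      ∫ ω, (z Ts n k ω - sample y Ts n k ω) * (z Ts n' k ω - sample y Ts n' k ω) ∂P = 0)
    (k : Fin K) (t : ℝ) :
    Recoverable (fun Ts => outputSpan P (z Ts)) (((hy t).1 k).toLp (y k t)) := by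
  classical
  have hs : ∀ Ts n, MemLp (sample y Ts n k) 2 P := fun Ts n => ((hy (n * Ts)).1 k).const_mul Ts
  have hz : ∀ Ts > 0, ∀ n, MemLp (z Ts n k) 2 P := fun Ts hTs n => by
    have := (hmem Ts hTs n k).add (hs Ts n)
    refine (memLp_congr_ae (Eventually.of_forall fun ω => ?_)).1 this
    simp
  -- Square integrability of `z` is known for positive periods only; the default value `0` elsewhere
  -- is never seen by the limit.
  let Z : ℝ → ℤ → Lp ℝ 2 P := fun Ts n =>
    if h : 0 < Ts then (hz Ts h n).toLp (z Ts n k) else 0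
  have hsub : ∀ Ts, ∀ hTs : 0 < Ts, ∀ n : ℤ, Z Ts n - Ts • ((hy (n * Ts)).1 k).toLp (y k (n * Ts)) =
      (hmem Ts hTs n k).toLp _ := by
    intro Ts hTs n
    simp only [Z, dif_pos hTs]
    rw [← MemLp.toLp_const_smul, ← MemLp.toLp_sub]
    rfl
  refine recoverable_of_samples (Y := fun t => ((hy t).1 k).toLp (y k t)) (Z := Z) (c := c)
    (continuous_toLp_output hx hH hy k) (fun Ts hTs n => ?_) (fun Ts hTs n n' hne => ?_)
    (fun Ts hTs n => ?_) t
  · rw [hsub Ts hTs, ← real_inner_self_eq_norm_sq, real_inner_toLp]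
    simpa only [pow_two (_ - _)] using hpow Ts hTs n k
  · rw [hsub Ts hTs, hsub Ts hTs, real_inner_toLp]
    exact horth Ts hTs n n' k hne
  · refine Submodule.subset_span ⟨n, k, ?_⟩
    simp only [Z, dif_pos (show 0 < Ts from hTs)]
    exact (hz Ts hTs n).coeFn_toLp

end Quantization

end

end TaskADC

/-! ### The theorem. -/

theorem lemma1 {Ω : Type*} [MeasurableSpace Ω] (P : Measure Ω) [IsProbabilityMeasure P]
    {M N K : ℕ} (hK : 1 ≤ K)
    -- the input signals, with band-limited power spectral density
    (x : Fin M → ℝ → Ω → ℝ) (C : ℝ → Matrix (Fin M) (Fin M) ℂ) (hx : TaskADC.IsWSS P x C)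
    (B : ℝ) (hB : ∀ f : ℝ, B < |f| → C f = 0)
    -- the task, whose MMSE estimate is linear in the input
    (s : Fin N → Ω → ℝ) (hs : ∀ i, MemLp (s i) 2 P) (hs0 : ∀ i, ∫ ω, s i ω ∂P = 0)
    (Γ : ℝ → Matrix (Fin N) (Fin M) ℂ) (hΓ : ∀ i m, Measurable fun f => Γ f i m)
    (hsΓ : TaskADC.IsFilterOutput P x C Γ 0 (TaskADC.mmseEstimate P x s))
    -- the analog filter and its output
    (H : ℝ → Matrix (Fin K) (Fin M) ℂ) (hH : ∀ k m, Measurable fun f => H f k m)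
    (y : Fin K → ℝ → Ω → ℝ) (hy : ∀ t, TaskADC.IsFilterOutput P x C H t fun k => y k t)
    (υ : ℕ) (hsuff : ∀ᶠ Ts : ℝ in 𝓝[>] 0, TaskADC.MaintainsSufficiency C Γ H υ Ts)
    -- the quantizers: resolution, dither and dynamic range at each sampling period
    (b : ℕ) (hb : 1 ≤ b) (η : ℝ) (hη : 0 < η) (γ : ℝ → ℝ) (w : ℝ → ℤ → Fin K → Ω → ℝ)
    (hw : ∀ Ts > 0, TaskADC.IsDither P x (TaskADC.stepSize b (γ Ts)) (w Ts))
    (hγ : ∀ Ts > 0, TaskADC.IsDynamicRange P η (γ Ts) (TaskADC.sample y Ts) (w Ts)) :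
    -- the closed-form expression of the achievable MSE
    Tendsto (fun Ts => TaskADC.mseExpression P C Γ H (TaskADC.mmseEstimate P x s)
      (TaskADC.stepSize b (γ Ts)) Ts) (𝓝[>] 0) (𝓝 0) ∧
    -- the minimum of the MSE over all linear digital filters, for quantizers that follow the
    -- equivalent additive model or are non-overloading dithered quantizers
    ∀ z : ℝ → ℤ → Fin K → Ω → ℝ,
      (∀ Ts > 0,
        TaskADC.IsAdditiveOutput P (TaskADC.stepSize b (γ Ts)) (TaskADC.sample y Ts) (z Ts) ∨
        TaskADC.IsDitheredOutput P b (γ Ts) (TaskADC.sample y Ts) (w Ts) (z Ts)) →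
      Tendsto (fun Ts => TaskADC.achievableMSE P (TaskADC.mmseEstimate P x s) (z Ts))
        (𝓝[>] 0) (𝓝 0) := by
  have hA := fun f => TaskADC.exists_mul_eq_of_sufficiency hsuff f
  have hΔ : ∀ Ts > 0, 0 < TaskADC.stepSize b (γ Ts) := fun Ts hTs =>
    TaskADC.stepSize_pos (hγ Ts hTs).1
  have hcases := TaskADC.stepSize_sq_le_or hK hx hH hy hη hw hγ
  refine ⟨TaskADC.tendsto_mseExpression hx hB hΓ hH hA hsΓ hΔ ?_, fun z hz => ?_⟩
  · rcases hcases with ⟨c, hc⟩ | hzero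
    · left
      -- The bound `Δ² ≤ c Ts²` gives `Δ² / (4 Ts) ≤ (c / 4) Ts`.
      have h1 : Tendsto (fun Ts : ℝ => c / 4 * Ts) (𝓝[>] 0) (𝓝 0) := by
        have h2 : Tendsto (fun Ts : ℝ => c / 4 * Ts) (𝓝 0) (𝓝 (c / 4 * 0)) :=
          tendsto_id.const_mul _
        rw [mul_zero] at h2
        exact h2.mono_left nhdsWithin_le_nhds
      refine squeeze_zero' ?_ ?_ h1
      · filter_upwards [self_mem_nhdsWithin] with Ts hTs
        have hT : 0 < Ts := hTs
        positivity
      · filter_upwards [self_mem_nhdsWithin] with Ts hTs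
        have hT : 0 < Ts := hTs
        rw [div_le_iff₀ (by positivity)]
        linarith [hc Ts hT]
    · right
      intro k
      have h1 := hzero k
      rw [(hy 0).integral_sq_eq hx hH k, integral_eq_zero_iff_of_nonneg (fun f => sq_nonneg _)
        ((hy 0).integrable_norm_sq_halfRow hx hH k)] at h1
      filter_upwards [h1] with f hf
      simpa using hf
  · refine TaskADC.tendsto_achievableMSE hsΓ.1 fun i => ?_
    refine TaskADC.Recoverable.of_mem_closure ?_ (hsΓ.mem_closure_span hx hΓ hH hA hy i)
    rintro _ ⟨⟨k, t⟩, rfl⟩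
    have hq := fun Ts (hTs : 0 < Ts) =>
      TaskADC.quantizationError_bounds hx hH hy (hγ Ts hTs).1 (hw Ts hTs) (hz Ts hTs)
    rcases hcases with ⟨c, hc⟩ | hzero
    · refine TaskADC.recoverable_output hx hH hy (c := 9 / 4 * c) (fun Ts hTs => (hq Ts hTs).1)
        (fun Ts hTs n k => ((hq Ts hTs).2.1 n k).trans ?_) (fun Ts hTs => (hq Ts hTs).2.2) k t
      linarith [hc Ts hTs]
    -- With no output power at time `0`, stationarity makes every generator of the closed span zero,
    -- so it is recovered by the zero filter.
    · have h1 : ((hy t).1 k).toLp (y k t) = 0 := by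
        rw [← norm_eq_zero, ← sq_eq_zero_iff, ← real_inner_self_eq_norm_sq,
          TaskADC.real_inner_toLp, ← hzero k, (hy 0).integral_sq_eq hx hH k,
          ← (hy t).integral_sq_eq hx hH k]
        simp only [pow_two]
      simp only [h1]
      exact TaskADC.Recoverable.zero
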